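/- Theorem. There is a single algorithm (a program for a word RAM with unit-cost instructions) and a constant $C$ such that the following holds for every finite simple undirected graph $G=(V,E)$ and every positive integer $k$. Let $n=|V|$, $m=|E|$, let $\Delta$ be the maximum degree of $G$, and put $p=(k\cdot\min\{n-k,\,k\Delta\})^2(\Delta+\log_2 k)$ if $k\le n$, and $p=0$ if $k>n$. Given $k$ and $G$ (by adjacency lists in any order) as input, the algorithm halts and outputs every set $X\subseteq V$ with $|X|=k$ for which the induced subgraph $G[X]$ is connected, each exactly once, and outputs nothing else. The time between any two successive outputs is at most $C\cdot\max\{1,p\}$, that is, the delay is $O\big((k\min\{n-k,k\Delta\})^2(\Delta+\log k)\big)$ up to an additive constant that matters only when $p=0$. The time before the first output, and the time from the last output (or from the start, if there is none) until the algorithm halts, are at most $C(n+m+1+p)$. The algorithm uses at most $C(n+m+1)$ memory cells, not counting the write-only output, and each cell holds a word of $O(\log(n+k))$ bits. -/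

import Mathlib

/-! A word RAM, presented as a structured programming language with unit-cost instructions.
The machine has finitely many registers (those occurring in the program), a random-access memory
of `S` cells, words with values below `W`, and a write-only output device. -/

namespace WordRAM

/-- An operand of an instruction: a literal or the content of a register. -/
inductive Operand
  | lit (c : ℕ)
  | reg (r : ℕ)

/-- An elementary test on two operands. -/
inductive Test
  | lt (a b : Operand)
  | eq (a b : Operand)

/-- Programs. Registers are named by natural numbers. -/
inductive Prog
  /-- do nothing -/
  | skip
  /-- `x := a` -/
  | assign (x : ℕ) (a : Operand)
  /-- `x := a + b` -/
  | add (x : ℕ) (a b : Operand)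
  /-- `x := max (a - b) 0` -/
  | sub (x : ℕ) (a b : Operand)
  /-- `x := M[a]` -/
  | load (x : ℕ) (a : Operand)
  /-- `M[a] := b` -/
  | store (a b : Operand)
  /-- write one word on the output device -/
  | emit (a : Operand)
  /-- declare that the words written since the last `flush` form one complete output -/
  | flush
  | seq (p q : Prog)
  | cond (t : Test) (p q : Prog)
  | loop (t : Test) (p : Prog)

/-- A state of the machine. `clock` counts executed instructions and tests; `out` lists the
completed outputs in chronological order, each with the time of its completion. -/
structure State where
  reg : ℕ → ℕ
  mem : ℕ → ℕ
  clock : ℕ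
  buf : List ℕ
  out : List (ℕ × List ℕ)

def Operand.val (s : State) : Operand → ℕ
  | .lit c => c
  | .reg r => s.reg r

def Test.holds (s : State) : Test → Prop
  | .lt a b => a.val s < b.val s
  | .eq a b => a.val s = b.val s

/-- One unit of time passes. -/
def State.tick (s : State) : State :=
  { s with clock := s.clock + 1 }

def State.setReg (s : State) (x v : ℕ) : State :=
  { s with reg := Function.update s.reg x v }

def State.setMem (s : State) (a v : ℕ) : State :=
  { s with mem := Function.update s.mem a v }

def State.write (s : State) (v : ℕ) : State :=
  { s with buf := s.buf ++ [v] }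

def State.complete (s : State) : State :=
  { s with buf := [], out := s.out ++ [(s.clock, s.buf)] }

/-- `Exec S W p s s'`: on a machine with `S` memory cells and words with values below `W`, the
program `p` started in state `s` halts in state `s'`. Every instruction and every test costs one
unit of time. Access to a cell outside the memory, or a value that does not fit into a word, is a
failure: such a run has no final state. -/
inductive Exec (S W : ℕ) : Prog → State → State → Prop
  | skip (s : State) : Exec S W .skip s s.tick
  | assign (s : State) (x : ℕ) (a : Operand) (h : a.val s < W) :
      Exec S W (.assign x a) s (s.setReg x (a.val s)).tick
  | add (s : State) (x : ℕ) (a b : Operand) (h : a.val s + b.val s < W) :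
      Exec S W (.add x a b) s (s.setReg x (a.val s + b.val s)).tick
  | sub (s : State) (x : ℕ) (a b : Operand) (h : a.val s - b.val s < W) :
      Exec S W (.sub x a b) s (s.setReg x (a.val s - b.val s)).tick
  | load (s : State) (x : ℕ) (a : Operand) (ha : a.val s < S) (h : s.mem (a.val s) < W) :
      Exec S W (.load x a) s (s.setReg x (s.mem (a.val s))).tick
  | store (s : State) (a b : Operand) (ha : a.val s < S) (h : b.val s < W) :
      Exec S W (.store a b) s (s.setMem (a.val s) (b.val s)).tick
  | emit (s : State) (a : Operand) (h : a.val s < W) :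
      Exec S W (.emit a) s (s.write (a.val s)).tick
  | flush (s : State) : Exec S W .flush s s.tick.complete
  | seq (p q : Prog) (s t u : State) (hp : Exec S W p s t) (hq : Exec S W q t u) :
      Exec S W (.seq p q) s u
  | condTrue (c : Test) (p q : Prog) (s t : State) (hc : c.holds s)
      (hp : Exec S W p s.tick t) : Exec S W (.cond c p q) s t
  | condFalse (c : Test) (p q : Prog) (s t : State) (hc : ¬ c.holds s)
      (hq : Exec S W q s.tick t) : Exec S W (.cond c p q) s t
  | loopDone (c : Test) (p : Prog) (s : State) (hc : ¬ c.holds s) :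
      Exec S W (.loop c p) s s.tick
  | loopStep (c : Test) (p : Prog) (s t u : State) (hc : c.holds s)
      (hp : Exec S W p s.tick t) (hl : Exec S W (.loop c p) t u) :
      Exec S W (.loop c p) s u

/-- The initial state: the input stands at the beginning of the memory, everything else is `0`. -/
def initState (input : List ℕ) : State where
  reg := fun _ => 0
  mem := fun i => input.getD i 0
  clock := 0
  buf := []
  out := []

end WordRAM

namespace ConnectedSets

/-- `adj` lists, for every vertex, its neighbours in `G`, each once and in any order. -/
def IsAdjacencyList {n : ℕ} (G : SimpleGraph (Fin n)) (adj : Fin n → List (Fin n)) : Prop :=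
  ∀ v, (adj v).Nodup ∧ ∀ w, w ∈ adj v ↔ G.Adj v w

/-- The input as a sequence of words: `n`, `k`, then `n + 1` addresses, then the concatenated
adjacency lists. The list of vertex `i` occupies the cells from the address in cell `2 + i`
up to, but excluding, the address in cell `3 + i`. -/
def encode {n : ℕ} (k : ℕ) (adj : Fin n → List (Fin n)) : List ℕ :=
  [n, k]
    ++ (List.range (n + 1)).map
        (fun i => n + 3 + (((List.finRange n).take i).map fun v => (adj v).length).sum)
    ++ (List.finRange n).flatMap fun v => (adj v).map Fin.val

/-- The vertex sets of size `k` that induce a connected subgraph. -/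
def connectedSets {n : ℕ} (G : SimpleGraph (Fin n)) (k : ℕ) : Set (Finset (Fin n)) :=
  {X | X.card = k ∧ (G.induce (X : Set (Fin n))).Connected}

/-- The list `L` of outputs consists of the members of `connectedSets G k`, each set listed exactly
once, and written as a repetition-free list of its vertices. -/
def Enumerates {n : ℕ} (G : SimpleGraph (Fin n)) (k : ℕ) (L : List (List ℕ)) : Prop :=
  (∀ l ∈ L, l.Nodup) ∧ (L.map List.toFinset).Nodup ∧
    ∀ Y : Finset ℕ, Y ∈ L.map List.toFinset ↔
      ∃ X ∈ connectedSets G k, X.map Fin.valEmbedding = Y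

/-- `(k * min {n - k, k * Δ}) ^ 2 * (Δ + log k)`. For `k > n` there is nothing to enumerate, and
the value is `0`. -/
noncomputable def delayBound (n k Δ : ℕ) : ℝ :=
  ((k * min (n - k) (k * Δ) : ℕ) : ℝ) ^ 2 * ((Δ : ℝ) + Real.logb 2 (k : ℝ))

end ConnectedSets

/-!
The algorithm is a binary partition. For a fixed root `r` it keeps a stack of decided vertices,
each one included in or excluded from the set under construction, and branches on a free neighbour
`u` of the included vertices: the solutions below the stack are those that contain `u` and those
that avoid `u`. The stack is extended greedily, by including free neighbours as long as there are
any. If `k` vertices get included, they are the only solution below the stack (`sol_eq_singleton`),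
and it is written. If the extension gets stuck before, no free vertex is adjacent to an included
one, so a connected set that respects the decisions is confined to fewer than `k` vertices, and
there is no solution (`sol_eq_empty`). Backtracking pops the stack: an included vertex becomes
excluded and the extension is tried again, and if it fails, the vertex is freed. The sets still to
be found are thus `Rem`, a union over the included vertices of the stack, and every greedy
extension preserves them (`sol_union_rem_push`, `disjoint_sol_rem`).

The roots are such that none is without a solution, for otherwise the search for the next fruitful
root could exceed the delay. Each component is explored greedily, so that every vertex but the first
has an earlier neighbour. All vertices but the first `k - 1` become roots, and the sets sought for a
root avoid the later roots. The root and the vertices before it form a connected set of at least `k`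
vertices, so the first extension succeeds (`Fruitful.not_closed`); and a connected `k`-set does
not fit into the first `k - 1` vertices of its component, so it contains a root.

As for time, let `μ = min (n - k) (k * Δ)`. Every excluded vertex is a neighbour of an included
one, so the stack of a solution has at most `k + μ` entries (`length_le_stackBound`). An extension
scans the stack and the neighbours of at most `k` vertices, in time `O(k + μ + k * Δ)`. Between two
outputs every entry of the stack is popped at most once, and at most one extension is tried for
each. If `k < n` and `Δ > 0`, this gives a delay of `O((k * μ) ^ 2 * Δ)` (`outputDelay_le`). If
`k = n`, there is at most one output and no extension is tried after it, so that the time for the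
end is linear. If `Δ = 0`, only `k = 1` has solutions, and the delay is constant.

The program is verified with a calculus of total correctness (`WordRAM.Run`), in which clock,
outputs, and the abstract search stack that the memory represents (`Config`, `Search`, `Prep`) are
tracked at the same time.
-/

namespace ConnectedSets

variable {n : ℕ}

/-! ### Search stacks -/

/-- The vertices of a search stack. A search stack is a list of decided vertices, the most recent
first; the flag tells whether the vertex was included in or excluded from the set under
construction. -/
def keys (l : List (Fin n × Bool)) : List (Fin n) := l.map Prod.fst

/-- The included vertices of a search stack. -/
def ins (l : List (Fin n × Bool)) : List (Fin n) := (l.filter Prod.snd).map Prod.fst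

/-- The excluded vertices of a search stack. -/
def outs (l : List (Fin n × Bool)) : List (Fin n) := (l.filter fun p => !p.2).map Prod.fst

@[simp] lemma keys_nil : keys ([] : List (Fin n × Bool)) = [] := rfl

@[simp] lemma keys_cons (p : Fin n × Bool) (l : List (Fin n × Bool)) :
    keys (p :: l) = p.1 :: keys l := rfl

@[simp] lemma length_keys (l : List (Fin n × Bool)) : (keys l).length = l.length := by
  simp [keys]

@[simp] lemma ins_nil : ins ([] : List (Fin n × Bool)) = [] := rfl

@[simp] lemma ins_cons_true (v : Fin n) (l : List (Fin n × Bool)) :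
    ins ((v, true) :: l) = v :: ins l := rfl

@[simp] lemma ins_cons_false (v : Fin n) (l : List (Fin n × Bool)) :
    ins ((v, false) :: l) = ins l := rfl

@[simp] lemma outs_nil : outs ([] : List (Fin n × Bool)) = [] := rfl

@[simp] lemma outs_cons_true (v : Fin n) (l : List (Fin n × Bool)) :
    outs ((v, true) :: l) = outs l := rfl

@[simp] lemma outs_cons_false (v : Fin n) (l : List (Fin n × Bool)) :
    outs ((v, false) :: l) = v :: outs l := rfl

lemma mem_ins {v : Fin n} {l : List (Fin n × Bool)} : v ∈ ins l ↔ (v, true) ∈ l := by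
  simp [ins]

lemma mem_outs {v : Fin n} {l : List (Fin n × Bool)} : v ∈ outs l ↔ (v, false) ∈ l := by
  simp [outs]

lemma mem_keys {v : Fin n} {l : List (Fin n × Bool)} : v ∈ keys l ↔ v ∈ ins l ∨ v ∈ outs l := by
  rw [mem_ins, mem_outs, keys]
  simp [or_comm]

lemma length_ins_add_length_outs (l : List (Fin n × Bool)) :
    (ins l).length + (outs l).length = l.length := by
  induction l with
  | nil => rfl
  | cons p l ih => rcases p with ⟨v, _ | _⟩ <;> simp <;> omega

lemma nodup_ins {l : List (Fin n × Bool)} (h : (keys l).Nodup) : (ins l).Nodup :=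
  h.sublist (List.filter_sublist.map _)

lemma nodup_outs {l : List (Fin n × Bool)} (h : (keys l).Nodup) : (outs l).Nodup :=
  h.sublist (List.filter_sublist.map _)

lemma notMem_ins_of_mem_outs {l : List (Fin n × Bool)} (h : (keys l).Nodup) {v : Fin n}
    (hv : v ∈ outs l) : v ∉ ins l := by
  intro hv'
  induction l with
  | nil => simp at hv
  | cons p l ih =>
    rw [keys_cons, List.nodup_cons] at h
    rcases p with ⟨u, _ | _⟩
    · simp only [outs_cons_false, ins_cons_false, List.mem_cons] at hv hv'
      rcases hv with rfl | hv
      · exact h.1 (mem_keys.2 (Or.inl hv'))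
      · exact ih h.2 hv hv'
    · simp only [outs_cons_true, ins_cons_true, List.mem_cons] at hv hv'
      rcases hv' with rfl | hv'
      · exact h.1 (mem_keys.2 (Or.inr hv))
      · exact ih h.2 hv hv'

/-- Include the vertices `E`, the first one last. -/
def push (E : List (Fin n)) (l : List (Fin n × Bool)) : List (Fin n × Bool) :=
  E.map (fun v => (v, true)) ++ l

@[simp] lemma push_nil (l : List (Fin n × Bool)) : push [] l = l := rfl

@[simp] lemma push_cons (v : Fin n) (E : List (Fin n)) (l : List (Fin n × Bool)) :
    push (v :: E) l = (v, true) :: push E l := rfl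

@[simp] lemma length_push (E : List (Fin n)) (l : List (Fin n × Bool)) :
    (push E l).length = E.length + l.length := by simp [push]

lemma push_push (E E' : List (Fin n)) (l : List (Fin n × Bool)) :
    push E (push E' l) = push (E ++ E') l := by simp [push]

lemma push_append (E : List (Fin n)) (l l' : List (Fin n × Bool)) :
    push E (l ++ l') = push E l ++ l' := by simp [push]

@[simp] lemma ins_push (E : List (Fin n)) (l : List (Fin n × Bool)) :
    ins (push E l) = E ++ ins l := by
  induction E with
  | nil => rfl
  | cons v E ih => simp [ih]

@[simp] lemma outs_push (E : List (Fin n)) (l : List (Fin n × Bool)) :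
    outs (push E l) = outs l := by
  induction E with
  | nil => rfl
  | cons v E ih => simp [ih]

@[simp] lemma keys_push (E : List (Fin n)) (l : List (Fin n × Bool)) :
    keys (push E l) = E ++ keys l := by
  induction E with
  | nil => rfl
  | cons v E ih => simp [ih]

/-- Every vertex of the stack except the bottom one is a neighbour of an included vertex below
it, and the bottom one is included. -/
def Linked (adj : Fin n → List (Fin n)) : List (Fin n × Bool) → Prop
  | [] => True
  | p :: l => ((l = [] ∧ p.2 = true) ∨ ∃ q ∈ ins l, p.1 ∈ adj q) ∧ Linked adj l

/-- Every neighbour of an included vertex is on the stack or forbidden. -/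
def Closed (adj : Fin n → List (Fin n)) (l : List (Fin n × Bool)) (F : List (Fin n)) : Prop :=
  ∀ v ∈ ins l, ∀ w ∈ adj v, w ∈ keys l ∨ w ∈ F

variable {G : SimpleGraph (Fin n)} {adj : Fin n → List (Fin n)}

lemma Linked.ins_ne_nil {l : List (Fin n × Bool)} (h : Linked adj l) (hl : l ≠ []) :
    ins l ≠ [] := by
  induction l with
  | nil => exact absurd rfl hl
  | cons p l ih =>
    rcases h with ⟨⟨_, h2⟩ | ⟨q, hq, -⟩, -⟩
    · rcases p with ⟨v, b⟩
      obtain rfl : b = true := h2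
      simp
    · have : ins l ≠ [] := List.ne_nil_of_mem hq
      rcases p with ⟨v, _ | _⟩ <;> simp [this]

lemma connected_insert {s : Set (Fin n)} {u v : Fin n} (hs : (G.induce s).Connected) (hv : v ∈ s)
    (huv : G.Adj v u) : (G.induce (insert u s)).Connected := by
  have h : (G.induce (s ∪ {u})).Connected :=
    SimpleGraph.connected_induce_union hs.preconnected
      (by intro a b; rw [Subsingleton.elim a b]) hv (Set.mem_singleton u) huv
  rwa [Set.union_singleton] at h

lemma Linked.connected (hadj : IsAdjacencyList G adj) {l : List (Fin n × Bool)}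
    (h : Linked adj l) (hl : l ≠ []) :
    (G.induce ((ins l).toFinset : Set (Fin n))).Connected := by
  induction l with
  | nil => exact absurd rfl hl
  | cons p l ih =>
    rcases p with ⟨v, b⟩
    rcases h with ⟨⟨h1, h2⟩ | ⟨q, hq, hv⟩, h3⟩
    · subst h1
      obtain rfl : b = true := h2
      have : ((ins [(v, true)]).toFinset : Set (Fin n)) = {v} := by ext; simp
      rw [this]
      exact SimpleGraph.induce_singleton_eq_top (G := G) v ▸ SimpleGraph.connected_top
    · have hne : l ≠ [] := by rintro rfl; simp at hq
      cases b
      · simpa using ih h3 hne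
      · have := connected_insert (ih h3 hne) (by simpa using hq) (((hadj q).2 v).1 hv)
        rwa [ins_cons_true, List.toFinset_cons, Finset.coe_insert]

/-- A connected set that meets `I` and cannot leave `I` along an edge lies in `I`. -/
lemma subset_of_connected {X I : Set (Fin n)} (hX : (G.induce X).Connected) {r : Fin n}
    (hr : r ∈ X) (hrI : r ∈ I) (h : ∀ v ∈ X, v ∈ I → ∀ w ∈ X, G.Adj v w → w ∈ I) : X ⊆ I := by
  intro x hx
  obtain ⟨p⟩ := hX.preconnected ⟨r, hr⟩ ⟨x, hx⟩
  have key : ∀ (a b : X), (G.induce X).Walk a b → (a : Fin n) ∈ I → (b : Fin n) ∈ I := by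
    intro a b p
    induction p with
    | nil => exact id
    | cons hab _ ih => exact fun ha => ih (h _ (Subtype.prop _) ha _ (Subtype.prop _) hab)
  exact key _ _ p hrI

/-- A connected set that meets the included vertices and avoids the excluded and the forbidden
ones is confined to the included vertices once the stack is closed. -/
lemma Closed.subset (hadj : IsAdjacencyList G adj) {l : List (Fin n × Bool)} {F : List (Fin n)}
    (h : Closed adj l F) {X : Finset (Fin n)} (hX : (G.induce (X : Set (Fin n))).Connected)
    {r : Fin n} (hr : r ∈ X) (hrl : r ∈ ins l) (ho : ∀ v ∈ outs l, v ∉ X) (hF : ∀ v ∈ F, v ∉ X) :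
    X ⊆ (ins l).toFinset := by
  have := subset_of_connected (I := ((ins l).toFinset : Set (Fin n))) hX (r := r) hr
    (by simpa using hrl) (by
      intro v _ hv w hw hvw
      have hv' : v ∈ ins l := by simpa using hv
      rcases h v hv' w (((hadj v).2 w).2 hvw) with hk | hk
      · rcases mem_keys.1 hk with hi | hi
        · simpa using hi
        · exact absurd hw (ho w hi)
      · exact absurd hw (hF w hk))
  exact_mod_cast this

/-- Excluded vertices are neighbours of included ones, which bounds their number. -/
lemma Linked.length_outs_le {l : List (Fin n × Bool)} (h : Linked adj l) (hn : (keys l).Nodup)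
    {D : ℕ} (hD : ∀ v, (adj v).length ≤ D) : (outs l).length ≤ (ins l).length * D := by
  have hsub : ∀ l : List (Fin n × Bool), Linked adj l →
      ∀ w ∈ outs l, ∃ q ∈ ins l, w ∈ adj q := by
    intro l
    induction l with
    | nil => simp
    | cons p l ih =>
      rcases p with ⟨v, b⟩
      rintro ⟨h1, h2⟩ w hw
      have hup : ∀ q ∈ ins l, q ∈ ins ((v, b) :: l) := by
        intro q hq; cases b <;> simp [hq]
      have hlow : w ∈ outs l → ∃ q ∈ ins ((v, b) :: l), w ∈ adj q := fun hw =>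
        let ⟨q, hq, hw⟩ := ih h2 w hw
        ⟨q, hup q hq, hw⟩
      cases b
      · simp only [outs_cons_false, List.mem_cons] at hw
        rcases hw with rfl | hw
        · rcases h1 with ⟨-, h1⟩ | ⟨q, hq, h1⟩
          · simp at h1
          · exact ⟨q, hup q hq, h1⟩
        · exact hlow hw
      · exact hlow hw
  have h1 : (outs l).toFinset ⊆ (ins l).toFinset.biUnion fun q => (adj q).toFinset := by
    intro w hw
    obtain ⟨q, hq, hw⟩ := hsub l h w (by simpa using hw)
    simp only [Finset.mem_biUnion, List.mem_toFinset]
    exact ⟨q, hq, hw⟩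
  have h2 := (Finset.card_le_card h1).trans (Finset.card_biUnion_le_card_mul _ _ D
    fun q _ => (List.toFinset_card_le _).trans (hD q))
  rwa [List.toFinset_card_of_nodup (nodup_outs hn), List.toFinset_card_of_nodup (nodup_ins hn)]
    at h2

/-! ### The partition of the solutions along the search -/

/-- The connected `k`-sets that agree with the decisions on the stack and avoid `F`. -/
def Sol (G : SimpleGraph (Fin n)) (k : ℕ) (l : List (Fin n × Bool)) (F : List (Fin n)) :
    Set (Finset (Fin n)) :=
  {X | X ∈ connectedSets G k ∧ (∀ v ∈ ins l, v ∈ X) ∧ (∀ v ∈ outs l, v ∉ X) ∧ ∀ v ∈ F, v ∉ X}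

/-- The solutions that are still to be found once the subtree of the search tree below `l` is
finished: those obtained by excluding an included vertex of the stack other than its bottom, and
those that meet the set `F` of later roots. -/
def Rem (G : SimpleGraph (Fin n)) (k : ℕ) (F : List (Fin n)) :
    List (Fin n × Bool) → Set (Finset (Fin n))
  | [] => {X | X ∈ connectedSets G k ∧ ∃ v ∈ F, v ∈ X}
  | [_] => {X | X ∈ connectedSets G k ∧ ∃ v ∈ F, v ∈ X}
  | (u, true) :: p :: l => Sol G k ((u, false) :: p :: l) F ∪ Rem G k F (p :: l)
  | (_, false) :: p :: l => Rem G k F (p :: l)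

variable {k : ℕ} {F : List (Fin n)}

lemma rem_cons_true (u : Fin n) {l : List (Fin n × Bool)} (hl : l ≠ []) :
    Rem G k F ((u, true) :: l) = Sol G k ((u, false) :: l) F ∪ Rem G k F l := by
  cases l with
  | nil => exact absurd rfl hl
  | cons p l => rfl

lemma rem_cons_false (u : Fin n) {l : List (Fin n × Bool)} (hl : l ≠ []) :
    Rem G k F ((u, false) :: l) = Rem G k F l := by
  cases l with
  | nil => exact absurd rfl hl
  | cons p l => rfl

lemma sol_union_rem_push (E : List (Fin n)) {l : List (Fin n × Bool)} (hl : l ≠ []) :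
    Sol G k (push E l) F ∪ Rem G k F (push E l) = Sol G k l F ∪ Rem G k F l := by
  induction E with
  | nil => rfl
  | cons u E ih =>
    have hne : push E l ≠ [] := by simp [push, hl]
    rw [← ih, push_cons, rem_cons_true u hne, ← Set.union_assoc]
    congr 1
    ext X
    simp only [Sol, Set.mem_union, Set.mem_ofPred_eq, ins_cons_true, outs_cons_true,
      ins_cons_false, outs_cons_false, List.forall_mem_cons]
    tauto

lemma disjoint_sol_rem {l : List (Fin n × Bool)} (hl : l ≠ []) :
    Disjoint (Sol G k l F) (Rem G k F l) := by
  induction l with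
  | nil => exact absurd rfl hl
  | cons p l ih =>
    rw [Set.disjoint_left] at ih ⊢
    rintro X ⟨hX, hi, ho, hF⟩
    clear hl
    by_cases hl : l = []
    · subst hl
      rintro ⟨-, v, hv, hvX⟩
      exact hF v hv hvX
    · rcases p with ⟨u, _ | _⟩
      · rw [rem_cons_false u hl]
        simp only [ins_cons_false, outs_cons_false, List.forall_mem_cons] at hi ho
        exact ih hl ⟨hX, hi, ho.2, hF⟩
      · rw [rem_cons_true u hl]
        simp only [ins_cons_true, outs_cons_true, List.forall_mem_cons] at hi ho
        rintro (h | h)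
        · exact h.2.2.1 u (by simp) hi.1
        · exact ih hl ⟨hX, hi.2, ho, hF⟩ h

/-- A stack with `k` included vertices is a leaf of the search tree. -/
lemma sol_eq_singleton (hadj : IsAdjacencyList G adj) {l : List (Fin n × Bool)}
    (hL : Linked adj l) (hl : l ≠ []) (hn : (keys l ++ F).Nodup) (hk : (ins l).length = k) :
    Sol G k l F = {(ins l).toFinset} := by
  have hn' : (keys l).Nodup := (List.nodup_append.1 hn).1
  have hcard : (ins l).toFinset.card = k := by
    rw [List.toFinset_card_of_nodup (nodup_ins hn'), hk]
  ext X
  constructor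
  · rintro ⟨hX, hi, -, -⟩
    refine (Finset.eq_of_subset_of_card_le (fun v hv => hi v (by simpa using hv)) ?_).symm
    rw [hX.1, hcard]
  · rintro rfl
    refine ⟨⟨hcard, hL.connected hadj hl⟩, by simp, ?_, ?_⟩
    · exact fun v hv hv' => notMem_ins_of_mem_outs hn' hv (by simpa using hv')
    · intro v hv hv'
      rw [List.mem_toFinset] at hv'
      exact (List.nodup_append.1 hn).2.2 v (mem_keys.2 (Or.inl hv')) v hv rfl

/-- If the greedy extension gets stuck before it has `k` vertices, the stack it started from
admits no solution. -/
lemma sol_eq_empty (hadj : IsAdjacencyList G adj) {l : List (Fin n × Bool)} {E : List (Fin n)}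
    (hL : Linked adj l) (hl : l ≠ []) (hn : (keys (push E l)).Nodup)
    (hc : Closed adj (push E l) F) (hk : (ins (push E l)).length < k) : Sol G k l F = ∅ := by
  rw [Set.eq_empty_iff_forall_notMem]
  rintro X ⟨hX, hi, ho, hF⟩
  obtain ⟨r, hr⟩ := List.exists_mem_of_ne_nil _ (hL.ins_ne_nil hl)
  have hsub := hc.subset hadj hX.2 (hi r hr) (by simp [hr]) (by simpa using ho) hF
  have := Finset.card_le_card hsub
  rw [List.toFinset_card_of_nodup (nodup_ins hn), hX.1] at this
  omega

/-- The condition on the list `R` of roots that makes every root fruitful: the root lies in a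
connected set with at least `k` vertices that avoids the later roots. -/
def Fruitful (G : SimpleGraph (Fin n)) (k : ℕ) : List (Fin n) → Prop
  | [] => True
  | r :: R => (∃ Y : Finset (Fin n), (G.induce (Y : Set (Fin n))).Connected ∧ r ∈ Y ∧
      k ≤ Y.card ∧ ∀ v ∈ R, v ∉ Y) ∧ Fruitful G k R

/-- The extension of a fruitful root cannot get stuck. -/
lemma Fruitful.not_closed (hadj : IsAdjacencyList G adj) {r : Fin n} {R E : List (Fin n)}
    (h : Fruitful G k (r :: R)) (hn : (keys (push E [(r, true)])).Nodup)
    (hc : Closed adj (push E [(r, true)]) R) : k ≤ (ins (push E [(r, true)])).length := by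
  obtain ⟨⟨Y, hY, hr, hk, hR⟩, -⟩ := h
  have hsub := hc.subset hadj hY hr (by simp) (by simp) hR
  have := Finset.card_le_card hsub
  rw [List.toFinset_card_of_nodup (nodup_ins hn)] at this
  omega

lemma Fruitful.eq_nil {r : Fin n} {R : List (Fin n)} (h : Fruitful G n (r :: R)) : R = [] := by
  obtain ⟨⟨Y, -, -, hk, hR⟩, -⟩ := h
  have : Y = Finset.univ := by
    rw [← Finset.card_eq_iff_eq_univ, Fintype.card_fin]
    exact le_antisymm (by simpa using Finset.card_le_univ Y) hk
  subst this
  exact List.eq_nil_iff_forall_not_mem.2 fun v hv => hR v hv (Finset.mem_univ v)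

lemma Fruitful.le {r : Fin n} {R : List (Fin n)} (h : Fruitful G k (r :: R)) : k ≤ n := by
  obtain ⟨⟨Y, -, -, hk, -⟩, -⟩ := h
  exact hk.trans (by simpa using Finset.card_le_univ Y)

lemma sol_union_rem_root (r : Fin n) (R : List (Fin n)) :
    Sol G k [(r, true)] R ∪ Rem G k R [(r, true)] = Rem G k (r :: R) [] := by
  ext X
  simp only [Sol, Rem, Set.mem_union, Set.mem_ofPred_eq, ins_cons_true, ins_nil, outs_cons_true,
    outs_nil, List.mem_cons, exists_eq_or_imp, List.not_mem_nil]
  by_cases h : ∃ v ∈ R, v ∈ X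
  · tauto
  · have : ∀ v ∈ R, v ∉ X := fun v hv hx => h ⟨v, hv, hx⟩
    simp only [forall_eq_or_imp, false_imp_iff, implies_true]
    tauto

end ConnectedSets

/-! ### Reasoning about programs -/

namespace WordRAM

/-- Total correctness: the run of `p` from `s` halts in a state that satisfies `Q`. -/
def Run (S W : ℕ) (p : Prog) (s : State) (Q : State → Prop) : Prop :=
  ∃ t, Exec S W p s t ∧ Q t

section Rules

variable {S W : ℕ} {p q : Prog} {s : State} {Q R : State → Prop}

lemma Run.mono (h : Run S W p s Q) (hQ : ∀ t, Q t → R t) : Run S W p s R :=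
  let ⟨t, ht, hq⟩ := h
  ⟨t, ht, hQ t hq⟩

lemma run_skip : Run S W .skip s Q ↔ Q s.tick :=
  ⟨fun ⟨_, h, hQ⟩ => by cases h; exact hQ, fun h => ⟨_, .skip s, h⟩⟩

lemma run_assign {x : ℕ} {a : Operand} :
    Run S W (.assign x a) s Q ↔ a.val s < W ∧ Q (s.setReg x (a.val s)).tick :=
  ⟨fun ⟨_, h, hQ⟩ => by cases h with | assign _ _ _ h => exact ⟨h, hQ⟩,
    fun ⟨h, hQ⟩ => ⟨_, .assign s x a h, hQ⟩⟩

lemma run_add {x : ℕ} {a b : Operand} :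
    Run S W (.add x a b) s Q ↔
      a.val s + b.val s < W ∧ Q (s.setReg x (a.val s + b.val s)).tick :=
  ⟨fun ⟨_, h, hQ⟩ => by cases h with | add _ _ _ _ h => exact ⟨h, hQ⟩,
    fun ⟨h, hQ⟩ => ⟨_, .add s x a b h, hQ⟩⟩

lemma run_sub {x : ℕ} {a b : Operand} :
    Run S W (.sub x a b) s Q ↔
      a.val s - b.val s < W ∧ Q (s.setReg x (a.val s - b.val s)).tick :=
  ⟨fun ⟨_, h, hQ⟩ => by cases h with | sub _ _ _ _ h => exact ⟨h, hQ⟩,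
    fun ⟨h, hQ⟩ => ⟨_, .sub s x a b h, hQ⟩⟩

lemma run_load {x : ℕ} {a : Operand} :
    Run S W (.load x a) s Q ↔
      a.val s < S ∧ s.mem (a.val s) < W ∧ Q (s.setReg x (s.mem (a.val s))).tick :=
  ⟨fun ⟨_, h, hQ⟩ => by cases h with | load _ _ _ ha h => exact ⟨ha, h, hQ⟩,
    fun ⟨ha, h, hQ⟩ => ⟨_, .load s x a ha h, hQ⟩⟩

lemma run_store {a b : Operand} :
    Run S W (.store a b) s Q ↔
      a.val s < S ∧ b.val s < W ∧ Q (s.setMem (a.val s) (b.val s)).tick :=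
  ⟨fun ⟨_, h, hQ⟩ => by cases h with | store _ _ _ ha h => exact ⟨ha, h, hQ⟩,
    fun ⟨ha, h, hQ⟩ => ⟨_, .store s a b ha h, hQ⟩⟩

lemma run_emit {a : Operand} :
    Run S W (.emit a) s Q ↔ a.val s < W ∧ Q (s.write (a.val s)).tick :=
  ⟨fun ⟨_, h, hQ⟩ => by cases h with | emit _ _ h => exact ⟨h, hQ⟩,
    fun ⟨h, hQ⟩ => ⟨_, .emit s a h, hQ⟩⟩

lemma run_flush : Run S W .flush s Q ↔ Q s.tick.complete :=
  ⟨fun ⟨_, h, hQ⟩ => by cases h; exact hQ, fun h => ⟨_, .flush s, h⟩⟩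

lemma run_seq : Run S W (.seq p q) s Q ↔ Run S W p s fun t => Run S W q t Q :=
  ⟨fun ⟨_, h, hQ⟩ => by cases h with | seq _ _ _ t _ hp hq => exact ⟨t, hp, _, hq, hQ⟩,
    fun ⟨t, hp, u, hq, hQ⟩ => ⟨u, .seq p q s t u hp hq, hQ⟩⟩

lemma run_cond {c : Test} :
    Run S W (.cond c p q) s Q ↔
      (c.holds s → Run S W p s.tick Q) ∧ (¬ c.holds s → Run S W q s.tick Q) := by
  constructor
  · rintro ⟨t, h, hQ⟩
    cases h with
    | condTrue _ _ _ _ _ hc hp => exact ⟨fun _ => ⟨t, hp, hQ⟩, fun h => absurd hc h⟩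
    | condFalse _ _ _ _ _ hc hp => exact ⟨fun h => absurd h hc, fun _ => ⟨t, hp, hQ⟩⟩
  · rintro ⟨h1, h2⟩
    by_cases hc : c.holds s
    · obtain ⟨t, hp, hQ⟩ := h1 hc
      exact ⟨t, .condTrue c p q s t hc hp, hQ⟩
    · obtain ⟨t, hp, hQ⟩ := h2 hc
      exact ⟨t, .condFalse c p q s t hc hp, hQ⟩

/-- The loop rule: `I m` is the invariant, indexed by a variant `m` that decreases. -/
lemma run_loop {c : Test} (I : ℕ → State → Prop) {m : ℕ} (h0 : I m s)
    (hstep : ∀ m s, I m s → c.holds s → Run S W p s.tick fun t => ∃ m' < m, I m' t)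
    (hdone : ∀ m s, I m s → ¬ c.holds s → Q s.tick) : Run S W (.loop c p) s Q := by
  induction m using Nat.strong_induction_on generalizing s with
  | _ m ih =>
    by_cases hc : c.holds s
    · obtain ⟨t, ht, m', hm, hI⟩ := hstep m s h0 hc
      obtain ⟨u, hu, hQ⟩ := ih m' hm hI
      exact ⟨u, .loopStep c p s t u hc ht hu, hQ⟩
    · exact ⟨_, .loopDone c p s hc, hdone m s h0 hc⟩

end Rules

section Projections

variable (s : State) (x v : ℕ)

@[simp] lemma reg_tick : s.tick.reg = s.reg := rfl
@[simp] lemma mem_tick : s.tick.mem = s.mem := rfl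
@[simp] lemma clock_tick : s.tick.clock = s.clock + 1 := rfl
@[simp] lemma buf_tick : s.tick.buf = s.buf := rfl
@[simp] lemma out_tick : s.tick.out = s.out := rfl
@[simp] lemma reg_setReg : (s.setReg x v).reg = Function.update s.reg x v := rfl
@[simp] lemma mem_setReg : (s.setReg x v).mem = s.mem := rfl
@[simp] lemma clock_setReg : (s.setReg x v).clock = s.clock := rfl
@[simp] lemma buf_setReg : (s.setReg x v).buf = s.buf := rfl
@[simp] lemma out_setReg : (s.setReg x v).out = s.out := rfl
@[simp] lemma reg_setMem : (s.setMem x v).reg = s.reg := rfl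
@[simp] lemma mem_setMem : (s.setMem x v).mem = Function.update s.mem x v := rfl
@[simp] lemma clock_setMem : (s.setMem x v).clock = s.clock := rfl
@[simp] lemma buf_setMem : (s.setMem x v).buf = s.buf := rfl
@[simp] lemma out_setMem : (s.setMem x v).out = s.out := rfl
@[simp] lemma reg_write : (s.write v).reg = s.reg := rfl
@[simp] lemma clock_write : (s.write v).clock = s.clock := rfl
@[simp] lemma buf_write : (s.write v).buf = s.buf ++ [v] := rfl
@[simp] lemma out_write : (s.write v).out = s.out := rfl
@[simp] lemma clock_complete : s.complete.clock = s.clock := rfl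
@[simp] lemma out_complete : s.complete.out = s.out ++ [(s.clock, s.buf)] := rfl

@[simp] lemma val_lit (c : ℕ) : (Operand.lit c).val s = c := rfl
@[simp] lemma val_reg (r : ℕ) : (Operand.reg r).val s = s.reg r := rfl
@[simp] lemma holds_lt (a b : Operand) : (Test.lt a b).holds s ↔ a.val s < b.val s := Iff.rfl
@[simp] lemma holds_eq (a b : Operand) : (Test.eq a b).holds s ↔ a.val s = b.val s := Iff.rfl

end Projections

end WordRAM

/-! ### The program -/

-- The registers. `rL` holds the length of the input, which is also the address of the search stack,
-- `rStat` the address of the status array in use, `rStat2` that of the array for the enumeration,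
-- and `rRoots` the address of the stack of roots. `rD` is the height of the search stack, `rCount`
-- the number of included vertices on it, `rLim` the limit for that number, and `rT` the number of
-- roots. `rI` scans the stack, `rA` and `rB` delimit a list of neighbours, `rU` runs through the
-- vertices.
local notation "rN" => (0 : ℕ)
local notation "rK" => (1 : ℕ)
local notation "rLim" => (2 : ℕ)
local notation "rL" => (3 : ℕ)
local notation "rStat" => (4 : ℕ)
local notation "rRoots" => (5 : ℕ)
local notation "rD" => (6 : ℕ)
local notation "rCount" => (7 : ℕ)
local notation "rI" => (8 : ℕ)
local notation "rV" => (9 : ℕ)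
local notation "rA" => (10 : ℕ)
local notation "rB" => (11 : ℕ)
local notation "rW" => (12 : ℕ)
local notation "rX" => (13 : ℕ)
local notation "rY" => (14 : ℕ)
local notation "rRun" => (15 : ℕ)
local notation "rD0" => (16 : ℕ)
local notation "rCount0" => (17 : ℕ)
local notation "rT" => (18 : ℕ)
local notation "rStat2" => (19 : ℕ)
local notation "rU" => (20 : ℕ)

local infixr:60 " ;; " => WordRAM.Prog.seq
local prefix:max "§" => WordRAM.Operand.lit
local prefix:max "®" => WordRAM.Operand.reg

namespace ConnectedSets

open WordRAM

/-- Visit the neighbour whose address is in `rA`: if it is free and the limit is not reached,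
include it. -/
def visitProg : Prog :=
  .load rW ®rA ;;
  .add rX ®rStat ®rW ;;
  .load rY ®rX ;;
  .cond (.eq ®rY §0)
    (.cond (.lt ®rCount ®rLim)
      (.store ®rX §1 ;;
       .add rX ®rL ®rD ;;
       .store ®rX ®rW ;;
       .add rD ®rD §1 ;;
       .add rCount ®rCount §1)
      .skip)
    .skip ;;
  .add rA ®rA §1

/-- Visit the neighbours of the vertex in `rV`. -/
def scanProg : Prog :=
  .add rX ®rV §2 ;;
  .load rA ®rX ;;
  .add rX ®rV §3 ;;
  .load rB ®rX ;;
  .loop (.lt ®rA ®rB) visitProg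

/-- Extend the search stack greedily: scan the included vertices on the stack, among them the
new ones, and include their free neighbours as long as the limit is not reached. The scan goes on
when the limit is reached; this does not affect the time bounds. -/
def extendProg : Prog :=
  .assign rI §0 ;;
  .loop (.lt ®rI ®rD)
    (.add rX ®rL ®rI ;;
     .load rV ®rX ;;
     .add rX ®rStat ®rV ;;
     .load rY ®rX ;;
     .cond (.eq ®rY §1) scanProg .skip ;;
     .add rI ®rI §1)

/-- Pop the top of the stack; leave the vertex in `rV` and the address of its status in `rX`. -/
def popProg : Prog :=
  .sub rD ®rD §1 ;;
  .add rX ®rL ®rD ;;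
  .load rV ®rX ;;
  .add rX ®rStat ®rV

/-- Write the included vertices on the output device. -/
def emitProg : Prog :=
  .assign rI §0 ;;
  .loop (.lt ®rI ®rD)
    (.add rX ®rL ®rI ;;
     .load rV ®rX ;;
     .add rX ®rStat ®rV ;;
     .load rY ®rX ;;
     .cond (.eq ®rY §1) (.emit ®rV) .skip ;;
     .add rI ®rI §1) ;;
  .flush

/-- Exclude the vertex just popped and extend; if this does not lead to `k` included vertices,
undo both. -/
def tryProg : Prog :=
  .store ®rX §2 ;;
  .assign rD0 ®rD ;;
  .assign rCount0 ®rCount ;;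
  .add rD ®rD §1 ;;
  extendProg ;;
  .cond (.eq ®rCount ®rK)
    (.assign rRun §0)
    (.assign rCount ®rCount0 ;;
     .loop (.lt ®rD0 ®rD) (popProg ;; .store ®rX §0))

/-- One step of backtracking. The register `rRun` is cleared when the next solution is found or
the stack is empty. For `k = n` no solution excludes a vertex, and attempts would take too long. -/
def backProg : Prog :=
  popProg ;;
  .load rY ®rX ;;
  .cond (.eq ®rY §2)
    (.store ®rX §0)
    (.sub rCount ®rCount §1 ;;
     .cond (.eq ®rD §0)
       (.store ®rX §0 ;; .assign rRun §0)
       (.cond (.lt ®rK ®rN) tryProg (.store ®rX §0)))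

/-- List the solutions that contain the root on the top of the stack of roots and avoid the
remaining roots. -/
def rootProg : Prog :=
  .sub rT ®rT §1 ;;
  .add rX ®rRoots ®rT ;;
  .load rV ®rX ;;
  .store ®rL ®rV ;;
  .add rX ®rStat ®rV ;;
  .store ®rX §1 ;;
  .assign rD §1 ;;
  .assign rCount §1 ;;
  extendProg ;;
  .loop (.lt §0 ®rD)
    (emitProg ;;
     .assign rRun §1 ;;
     .loop (.eq ®rRun §1) backProg)

/-- Empty the stack, which holds a whole component; all its vertices but the `k - 1` lowest on
the stack become roots. -/
def collectProg : Prog :=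
  .loop (.lt §0 ®rD)
    (.assign rY ®rD ;;
     popProg ;;
     .store ®rX §2 ;;
     .sub rCount ®rCount §1 ;;
     .cond (.lt ®rY ®rK)
       .skip
       (.add rX ®rStat2 ®rV ;;
        .store ®rX §2 ;;
        .add rX ®rRoots ®rT ;;
        .store ®rX ®rV ;;
        .add rT ®rT §1))

/-- Explore the component of the vertex in `rU`, unless it has been visited, and collect its
roots. -/
def componentProg : Prog :=
  .add rX ®rStat ®rU ;;
  .load rY ®rX ;;
  .cond (.eq ®rY §0)
    (.store ®rX §1 ;;
     .store ®rL ®rU ;;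
     .assign rD §1 ;;
     .assign rCount §1 ;;
     extendProg ;;
     collectProg)
    .skip ;;
  .add rU ®rU §1

/-- Read the parameters and lay out the memory: behind the input come the search stack, two
status arrays and the stack of roots, of `n` cells each. -/
def setupProg : Prog :=
  .load rN §0 ;;
  .load rK §1 ;;
  .add rX ®rN §2 ;;
  .load rL ®rX ;;
  .add rStat ®rL ®rN ;;
  .add rStat2 ®rStat ®rN ;;
  .add rRoots ®rStat2 ®rN ;;
  .add rLim ®rN §1

/-- The enumeration algorithm. -/
def mainProg : Prog :=
  setupProg ;;
  .loop (.lt ®rU ®rN) componentProg ;;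
  .assign rStat ®rStat2 ;;
  .assign rLim ®rK ;;
  .loop (.lt §0 ®rT) rootProg

section

/-! ### The data structures in memory -/

variable {n : ℕ}

/-- The length of the input. -/
def inputSize (adj : Fin n → List (Fin n)) : ℕ :=
  n + 3 + ((List.finRange n).map fun v => (adj v).length).sum

/-- The address of the list of neighbours of `v`. -/
def offset (adj : Fin n → List (Fin n)) (v : Fin n) : ℕ :=
  n + 3 + (((List.finRange n).take v).map fun v => (adj v).length).sum

/-- The memory holds the graph in the input format. -/
structure GraphAt (adj : Fin n → List (Fin n)) (mem : ℕ → ℕ) : Prop where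
  lo : ∀ v : Fin n, mem (v + 2) = offset adj v
  hi : ∀ v : Fin n, mem (v + 3) = offset adj v + (adj v).length
  nbr : ∀ (v : Fin n) (j : ℕ) (h : j < (adj v).length), mem (offset adj v + j) = (adj v)[j]

/-- The cells from address `b` on hold the stack `l`, with its bottom at address `b`. -/
def StackAt (mem : ℕ → ℕ) (b : ℕ) : List (Fin n) → Prop
  | [] => True
  | v :: l => mem (b + l.length) = v ∧ StackAt mem b l

/-- The status of a vertex: `1` for included, `2` for excluded or forbidden, `0` for free. -/
def status (l : List (Fin n × Bool)) (F : List (Fin n)) (v : Fin n) : ℕ :=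
  if v ∈ ins l then 1 else if v ∈ outs l ∨ v ∈ F then 2 else 0

/-- The memory holds the graph, the search stack `l`, and at address `b` the status of the
vertices for the search stack `l` and the forbidden vertices `F`. -/
structure Store (adj : Fin n → List (Fin n)) (mem : ℕ → ℕ) (b : ℕ) (l : List (Fin n × Bool))
    (F : List (Fin n)) : Prop where
  graph : GraphAt adj mem
  stack : StackAt mem (inputSize adj) (keys l)
  stat : ∀ v : Fin n, mem (b + v) = status l F v
  nodup : (keys l ++ F).Nodup
  linked : Linked adj l

variable {adj : Fin n → List (Fin n)} {mem mem' : ℕ → ℕ} {b : ℕ} {l : List (Fin n × Bool)}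
  {F : List (Fin n)}

lemma offset_add_le (v : Fin n) : offset adj v + (adj v).length ≤ inputSize adj := by
  have h : (List.finRange n).take (v + 1) = (List.finRange n).take v ++ [v] := by
    rw [List.take_add_one]
    simp
  have h1 : ((((List.finRange n).take (v + 1)).map fun v => (adj v).length)).sum ≤
      ((List.finRange n).map fun v => (adj v).length).sum :=
    ((List.take_sublist _ _).map _).sum_le_sum (by simp)
  rw [h, List.map_append, List.sum_append, List.map_singleton, List.sum_singleton] at h1
  simp only [offset, inputSize]
  omega

lemma le_inputSize : n + 3 ≤ inputSize adj := by simp [inputSize]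

lemma GraphAt.congr (h : GraphAt adj mem) (h' : ∀ a < inputSize adj, mem' a = mem a) :
    GraphAt adj mem' where
  lo v := by
    rw [h' _ (by have := v.2; have := le_inputSize (adj := adj); omega)]
    exact h.lo v
  hi v := by
    rw [h' _ (by have := v.2; have := le_inputSize (adj := adj); omega)]
    exact h.hi v
  nbr v j hj := by
    rw [h' _ (by have := offset_add_le (adj := adj) v; omega)]
    exact h.nbr v j hj

lemma StackAt.congr {l : List (Fin n)} (h : StackAt mem b l)
    (h' : ∀ i < l.length, mem' (b + i) = mem (b + i)) : StackAt mem' b l := by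
  induction l with
  | nil => trivial
  | cons v l ih =>
    exact ⟨(h' _ (by simp)).trans h.1, ih h.2 fun i hi => h' i (by simp; omega)⟩

lemma StackAt.append {l₁ l₂ : List (Fin n)} {v : Fin n} (h : StackAt mem b (l₁ ++ v :: l₂)) :
    mem (b + l₂.length) = v := by
  induction l₁ with
  | nil => exact h.1
  | cons u l₁ ih => exact ih h.2

lemma status_eq_zero {v : Fin n} : status l F v = 0 ↔ v ∉ keys l ∧ v ∉ F := by
  rw [mem_keys, status]
  split_ifs <;> simp <;> tauto

lemma status_congr {l' : List (Fin n × Bool)} {F' : List (Fin n)} {v : Fin n}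
    (h1 : v ∈ ins l' ↔ v ∈ ins l) (h2 : v ∈ outs l' ∨ v ∈ F' ↔ v ∈ outs l ∨ v ∈ F) :
    status l' F' v = status l F v :=
  if_congr h1 rfl (if_congr h2 rfl rfl)

lemma status_eq_one {v : Fin n} : status l F v = 1 ↔ v ∈ ins l := by
  rw [status]
  split_ifs <;> simp <;> tauto

namespace Store

lemma length_le (h : Store adj mem b l F) : l.length + F.length ≤ n := by
  have := h.nodup.length_le_card
  simpa using this

lemma congr (h : Store adj mem b l F) (h1 : ∀ a < inputSize adj + n, mem' a = mem a)
    (h2 : ∀ v : Fin n, mem' (b + v) = mem (b + v)) : Store adj mem' b l F where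
  graph := h.graph.congr fun a ha => h1 a (by omega)
  stack := h.stack.congr fun i hi => h1 _ (by
    have := h.length_le
    simp at hi
    omega)
  stat v := (h2 v).trans (h.stat v)
  nodup := h.nodup
  linked := h.linked

lemma nodup_keys (h : Store adj mem b l F) : (keys l).Nodup := (List.nodup_append.1 h.nodup).1

/-- Changing the status of one vertex. -/
lemma graph_update (h : Store adj mem b l F) (hb : inputSize adj + n ≤ b) (v : Fin n) (x : ℕ) :
    GraphAt adj (Function.update mem (b + v) x) :=
  h.graph.congr fun a ha => Function.update_of_ne (by omega) _ _

lemma stack_update {l' : List (Fin n)} (h : StackAt mem (inputSize adj) l') (hl : l'.length ≤ n)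
    (hb : inputSize adj + n ≤ b) (v : Fin n) (x : ℕ) :
    StackAt (Function.update mem (b + v) x) (inputSize adj) l' :=
  h.congr fun i hi => Function.update_of_ne (by omega) _ _

lemma stat_update {l' : List (Fin n × Bool)} {F' : List (Fin n)} (h : Store adj mem b l F)
    (v : Fin n) (h' : ∀ u, u ≠ v → status l' F' u = status l F u) (u : Fin n) :
    Function.update mem (b + v) (status l' F' v) (b + u) = status l' F' u := by
  by_cases huv : u = v
  · subst huv
    simp
  · have : (u : ℕ) ≠ v := fun h => huv (Fin.ext h)
    rw [Function.update_of_ne (by omega), h' u huv, h.stat u]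

/-- Including the free vertex `w`. -/
lemma pushTop (h : Store adj mem b l F) (hb : inputSize adj + n ≤ b) {w : Fin n}
    (hw : w ∉ keys l) (hF : w ∉ F) (hl : l = [] ∨ ∃ q ∈ ins l, w ∈ adj q) :
    Store adj (Function.update (Function.update mem (b + w) 1) (inputSize adj + l.length) w) b
      ((w, true) :: l) F := by
  have hn : (keys ((w, true) :: l) ++ F).Nodup := by
    rw [keys_cons, List.cons_append, List.nodup_cons]
    exact ⟨by simp [hw, hF], h.nodup⟩
  have hlen : l.length < n := by
    have := hn.length_le_card
    simp at this
    omega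
  refine ⟨(h.graph_update hb w 1).congr fun a ha => Function.update_of_ne (by omega) _ _,
    ⟨by simp, ?_⟩, fun v => ?_, hn, ⟨by simpa using hl, h.linked⟩⟩
  · exact (stack_update h.stack (by simp; omega) hb w 1).congr fun i hi =>
      Function.update_of_ne (by simp at hi; omega) _ _
  · rw [Function.update_of_ne (by omega)]
    have h1 : status ((w, true) :: l) F w = 1 := by rw [status_eq_one]; simp
    rw [← h1]
    refine h.stat_update w (fun u hu => ?_) v
    exact status_congr (by simp [hu]) (by simp)

/-- Freeing the top of the stack. -/
lemma popTop {p : Fin n × Bool} (h : Store adj mem b (p :: l) F) (hb : inputSize adj + n ≤ b) :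
    Store adj (Function.update mem (b + p.1) 0) b l F := by
  have hn := h.nodup
  rw [keys_cons, List.cons_append, List.nodup_cons, List.mem_append, not_or] at hn
  have hlen := h.length_le
  rw [List.length_cons] at hlen
  refine ⟨h.graph_update hb _ _, stack_update h.stack.2 (by simp; omega) hb _ _, fun v => ?_,
    hn.2, h.linked.2⟩
  have h1 : status l F p.1 = 0 := status_eq_zero.2 hn.1
  rw [← h1]
  refine h.stat_update p.1 (fun u hu => ?_) v
  rcases p with ⟨p, _ | _⟩
  · exact status_congr (by simp) (by simp_all)
  · exact status_congr (by simp_all) (by simp)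

/-- Excluding the top of the stack, which was included. -/
lemma flipTop {u : Fin n} (h : Store adj mem b ((u, true) :: l) F) (hb : inputSize adj + n ≤ b)
    (hl : l ≠ []) : Store adj (Function.update mem (b + u) 2) b ((u, false) :: l) F := by
  have hn := h.nodup
  rw [keys_cons, List.cons_append, List.nodup_cons, List.mem_append, not_or] at hn
  have hlen := h.length_le
  refine ⟨h.graph_update hb _ _,
    stack_update (l' := keys ((u, false) :: l)) h.stack (by simp at hlen ⊢; omega) hb _ _,
    fun v => ?_, h.nodup, ?_, h.linked.2⟩
  · have h1 : status ((u, false) :: l) F u = 2 := by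
      have : u ∉ ins l := fun h => hn.1.1 (mem_keys.2 (Or.inl h))
      simp [status, this]
    rw [← h1]
    refine h.stat_update u (fun w hw => ?_) v
    exact status_congr (by simp [hw]) (by simp [hw])
  · right
    rcases h.linked.1 with ⟨h1, -⟩ | h1
    · exact absurd h1 hl
    · exact h1

/-- Removing the top of the stack and forbidding it. -/
lemma forbidTop {u : Fin n} (h : Store adj mem b ((u, true) :: l) F)
    (hb : inputSize adj + n ≤ b) : Store adj (Function.update mem (b + u) 2) b l (u :: F) := by
  have hn := h.nodup
  have hn' := hn
  rw [keys_cons, List.cons_append, List.nodup_cons, List.mem_append, not_or] at hn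
  have hlen := h.length_le
  refine ⟨h.graph_update hb _ _, stack_update h.stack.2 (by simp at hlen ⊢; omega) hb _ _,
    fun v => ?_, List.nodup_middle.2 hn', h.linked.2⟩
  have h1 : status l (u :: F) u = 2 := by
    have : u ∉ ins l := fun h => hn.1.1 (mem_keys.2 (Or.inl h))
    simp [status, this]
  rw [← h1]
  refine h.stat_update u (fun w hw => ?_) v
  exact status_congr (by simp [hw]) (by simp [hw])

/-- Starting with a root, which is forbidden no longer. -/
lemma pushRoot {r : Fin n} (h : Store adj mem b [] (r :: F)) (hb : inputSize adj + n ≤ b) :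
    Store adj (Function.update (Function.update mem (inputSize adj) r) (b + r) 1) b
      [(r, true)] F := by
  have hn : 0 < n := r.pos
  have hc : Store adj (Function.update mem (inputSize adj) r) b [] (r :: F) :=
    ⟨h.graph.congr fun a ha => Function.update_of_ne (by omega) _ _, trivial,
      fun v => by rw [Function.update_of_ne (by omega)]; exact h.stat v, h.nodup, trivial⟩
  refine ⟨hc.graph_update hb _ _,
    stack_update (l' := [r]) ⟨by simp, trivial⟩ (by simp; omega) hb _ _,
    fun v => ?_, h.nodup, Or.inl ⟨rfl, rfl⟩, trivial⟩
  have h1 : status [(r, true)] F r = 1 := by rw [status_eq_one]; simp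
  rw [← h1]
  refine hc.stat_update r (fun w hw => ?_) v
  exact status_congr (by simp [hw]) (by simp [hw])

end Store

/-! ### Greedy extension of the stack -/

/-- The memory has room for the search stack and for a status array at address `b`, and the
words are large enough for the addresses. -/
structure Room (adj : Fin n → List (Fin n)) (S W b : ℕ) : Prop where
  above : inputSize adj + n ≤ b
  le : b + n ≤ S
  lt : b + n + 4 ≤ W

/-- The search stack is `l`, the vertices in `F` are forbidden, and the status array at address
`b` is in use. -/
structure Config (adj : Fin n → List (Fin n)) (s : State) (b : ℕ) (l : List (Fin n × Bool))
    (F : List (Fin n)) : Prop where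
  store : Store adj s.mem b l F
  regL : s.reg rL = inputSize adj
  regStat : s.reg rStat = b
  regD : s.reg rD = l.length
  regCount : s.reg rCount = (ins l).length

/-- The effect of the search routines is confined to the registers from `rD` to
`top`, the search
stack, and the status array at address `b`. -/
structure Frame (adj : Fin n → List (Fin n)) (b top : ℕ) (s t : State) : Prop where
  reg : ∀ r, r < rD ∨ top < r → t.reg r = s.reg r
  mem : ∀ a, a < inputSize adj ∨ inputSize adj + n ≤ a → a < b ∨ b + n ≤ a → t.mem a = s.mem a
  buf : t.buf = s.buf
  out : t.out = s.out

variable {top : ℕ}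

lemma Frame.rfl {s : State} : Frame adj b top s s :=
  ⟨fun _ _ => Eq.refl _, fun _ _ _ => Eq.refl _, Eq.refl _, Eq.refl _⟩

lemma Frame.trans {s t u : State} (h : Frame adj b top s t) (h' : Frame adj b top t u) :
    Frame adj b top s u :=
  ⟨fun r hr => (h'.reg r hr).trans (h.reg r hr),
    fun a h1 h2 => (h'.mem a h1 h2).trans (h.mem a h1 h2), h'.buf.trans h.buf,
    h'.out.trans h.out⟩

lemma Frame.mono {top' : ℕ} {s t : State} (h : Frame adj b top s t) (ht : top ≤ top') :
    Frame adj b top' s t :=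
  ⟨fun r hr => h.reg r (by omega), h.mem, h.buf, h.out⟩

lemma Frame.tick {s t : State} (h : Frame adj b top s t) : Frame adj b top s t.tick :=
  ⟨h.reg, h.mem, h.buf, h.out⟩

lemma Frame.setReg {s t : State} (h : Frame adj b top s t) {r x : ℕ} (hr : rD ≤ r ∧ r ≤ top) :
    Frame adj b top s (t.setReg r x) :=
  ⟨fun r' hr' => (Function.update_of_ne (by omega) _ _).trans (h.reg r' hr'), h.mem, h.buf, h.out⟩

lemma Frame.setStack {s t : State} (h : Frame adj b top s t) {i x : ℕ} (hi : i < n) :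
    Frame adj b top s (t.setMem (inputSize adj + i) x) :=
  ⟨h.reg, fun a h1 h2 => (Function.update_of_ne (by omega) _ _).trans (h.mem a h1 h2), h.buf,
    h.out⟩

lemma Frame.setStat {s t : State} (h : Frame adj b top s t) (v : Fin n) {x : ℕ} :
    Frame adj b top s (t.setMem (b + v) x) :=
  ⟨h.reg, fun a h1 h2 => (Function.update_of_ne (by omega) _ _).trans (h.mem a h1 h2), h.buf,
    h.out⟩

lemma status_le (l : List (Fin n × Bool)) (F : List (Fin n)) (v : Fin n) : status l F v ≤ 2 := by
  unfold status
  split_ifs <;> simp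

lemma length_ins_le (l : List (Fin n × Bool)) : (ins l).length ≤ l.length := by
  have := length_ins_add_length_outs l
  omega

variable {S W : ℕ} {s : State}

lemma run_visit (hR : Room adj S W b) (hC : Config adj s b l F) {w : Fin n}
    (hlim : (ins l).length ≤ s.reg rLim) (ha : s.reg rA < inputSize adj)
    (hw : s.mem (s.reg rA) = w) (hl : ∃ q ∈ ins l, w ∈ adj q) :
    Run S W visitProg s fun t => ∃ E, Config adj t b (push E l) F ∧
      (ins (push E l)).length ≤ s.reg rLim ∧
      ((ins (push E l)).length < s.reg rLim → w ∈ keys (push E l) ∨ w ∈ F) ∧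
      t.reg rA = s.reg rA + 1 ∧ t.reg rB = s.reg rB ∧ t.reg rV = s.reg rV ∧ t.reg rI = s.reg rI ∧
      Frame adj b rY s t ∧ t.clock ≤ s.clock + 11 := by
  have h1 := hR.above
  have h2 := hR.le
  have h3 := hR.lt
  have h4 := w.2
  have h5 := hC.store.stat w
  have h6 := status_le l F w
  have h7 := hC.store.length_le
  have h8 := length_ins_le l
  simp only [visitProg, run_seq, run_load, run_add, run_cond, run_store, run_skip, val_reg,
    val_lit, reg_tick, reg_setReg, reg_setMem, mem_tick, mem_setReg, holds_eq,
    holds_lt, Function.update_self, ne_eq, not_false_eq_true,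
    Function.update_of_ne, Nat.reduceEqDiff, hC.regL, hC.regStat, hC.regD, hC.regCount, hw, h5]
  refine ⟨by omega, by omega, by omega, by omega, by omega, fun h0 => ⟨fun hlt => ?_, ?_⟩, ?_⟩
  · rw [status_eq_zero] at h0
    have hS := hC.store.pushTop h1 h0.1 h0.2 (Or.inr hl)
    have h9 := hS.length_le
    rw [List.length_cons] at h9
    refine ⟨by omega, by omega, by omega, by omega, by omega, by omega, by omega, by omega,
      [w], ⟨hS, ?_, ?_, ?_, ?_⟩, ?_, ?_, ?_, ?_, ?_, ?_, ?_, ?_⟩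
    any_goals simp [hC.regL, hC.regStat]
    · omega
    · repeat first
        | exact Frame.rfl
        | apply Frame.tick
        | refine Frame.setReg ?_ (by norm_num)
        | refine Frame.setStack ?_ (by omega)
        | refine Frame.setStat ?_ _
  · intro hge
    refine ⟨by omega, [], ⟨hC.store, ?_, ?_, ?_, ?_⟩, hlim, ?_, ?_, ?_, ?_, ?_, ?_, ?_⟩
    any_goals simp [hC.regL, hC.regStat, hC.regD, hC.regCount]
    · omega
    · repeat first
        | exact Frame.rfl
        | apply Frame.tick
        | refine Frame.setReg ?_ (by norm_num)
  · intro h0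
    rw [status_eq_zero] at h0
    refine ⟨by omega, [], ⟨hC.store, ?_, ?_, ?_, ?_⟩, hlim, ?_, ?_, ?_, ?_, ?_, ?_, ?_⟩
    any_goals simp [hC.regL, hC.regStat, hC.regD, hC.regCount]
    · tauto
    · repeat first
        | exact Frame.rfl
        | apply Frame.tick
        | refine Frame.setReg ?_ (by norm_num)

end

section

variable {n : ℕ} {adj : Fin n → List (Fin n)} {b : ℕ} {l : List (Fin n × Bool)}
  {F : List (Fin n)} {S W : ℕ} {s : State}

lemma run_scan (hR : Room adj S W b) (hC : Config adj s b l F) {v : Fin n}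
    (hlim : (ins l).length ≤ s.reg rLim) (hv : s.reg rV = v) (hl : v ∈ ins l) :
    Run S W scanProg s fun t => ∃ E, Config adj t b (push E l) F ∧
      (ins (push E l)).length ≤ s.reg rLim ∧
      ((ins (push E l)).length < s.reg rLim → ∀ w ∈ adj v, w ∈ keys (push E l) ∨ w ∈ F) ∧
      t.reg rI = s.reg rI ∧ Frame adj b rY s t ∧ t.clock ≤ s.clock + 5 + 12 * (adj v).length := by
  have h1 := hR.above
  have h2 := hR.le
  have h3 := hR.lt
  have h4 := v.2
  have h5 := hC.store.graph.lo v
  have h6 := hC.store.graph.hi v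
  have h7 := offset_add_le (adj := adj) v
  have h8 := le_inputSize (adj := adj)
  simp only [scanProg, run_seq, run_load, run_add, val_reg,
    val_lit, reg_tick, reg_setReg, mem_tick, mem_setReg, Function.update_self, ne_eq,
    not_false_eq_true, Function.update_of_ne, Nat.reduceEqDiff, hv, h5, h6]
  refine ⟨by omega, by omega, by omega, by omega, by omega, by omega, ?_⟩
  refine run_loop (fun m t => ∃ E j, j + m = (adj v).length ∧ Config adj t b (push E l) F ∧
    (ins (push E l)).length ≤ s.reg rLim ∧
    ((ins (push E l)).length < s.reg rLim →
      ∀ i (h : i < (adj v).length), i < j → (adj v)[i] ∈ keys (push E l) ∨ (adj v)[i] ∈ F) ∧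
    t.reg rA = offset adj v + j ∧ t.reg rB = offset adj v + (adj v).length ∧
    t.reg rI = s.reg rI ∧ Frame adj b rY s t ∧ t.clock ≤ s.clock + 4 + 12 * j)
    (m := (adj v).length) ?_ ?_ ?_
  · refine ⟨[], 0, by simp, ⟨hC.store, ?_, ?_, ?_, ?_⟩, hlim, ?_, ?_, ?_, ?_, ?_, ?_⟩
    any_goals simp [hC.regL, hC.regStat, hC.regD, hC.regCount]
    repeat first
      | exact Frame.rfl
      | apply Frame.tick
      | refine Frame.setReg ?_ (by norm_num)
  · rintro m t ⟨E, j, hj, hC', hlim', hdone, hA, hB, hI, hF, hclock⟩ hlt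
    simp only [holds_lt, val_reg, hA, hB, Nat.add_lt_add_iff_left] at hlt
    have hL : t.reg rLim = s.reg rLim := hF.reg _ (by norm_num)
    have hC'' : Config adj t.tick b (push E l) F :=
      ⟨hC'.store, hC'.regL, hC'.regStat, hC'.regD, hC'.regCount⟩
    refine (run_visit hR hC'' (w := (adj v)[j]) (by simpa [hL] using hlim') ?_ ?_
      ⟨v, by simp [hl], by simp⟩).mono ?_
    · simp only [reg_tick, hA]
      omega
    · simp only [reg_tick, mem_tick, hA]
      exact hC'.store.graph.nbr v j hlt
    · rintro u ⟨E', hu, hlim'', hw, huA, huB, -, huI, hF', hclock'⟩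
      simp only [reg_tick, hL, hA, hB, hI, clock_tick] at hlim'' hw huA huB huI hclock'
      rw [push_push] at hu hlim'' hw
      refine ⟨m - 1, by omega, E' ++ E, j + 1, by omega, hu, hlim'', ?_, huA, huB, huI,
        (hF.trans (Frame.rfl.tick)).trans hF', by omega⟩
      intro hlt' i hi hij
      rcases Nat.lt_succ_iff_lt_or_eq.1 hij with hij | rfl
      · have := hdone (by simp at hlt' ⊢; omega) i hi hij
        simp only [keys_push, List.mem_append] at this ⊢
        tauto
      · exact hw hlt'
  · rintro m t ⟨E, j, hj, hC', hlim', hdone, hA, hB, hI, hF, hclock⟩ hlt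
    simp only [holds_lt, val_reg, hA, hB, Nat.add_lt_add_iff_left, not_lt] at hlt
    refine ⟨E, ⟨hC'.store, hC'.regL, hC'.regStat, hC'.regD, hC'.regCount⟩, hlim', ?_, hI,
      hF.tick, ?_⟩
    · intro hlt' w hw
      obtain ⟨i, hi, rfl⟩ := List.getElem_of_mem hw
      exact hdone hlt' i hi (by omega)
    · simp only [clock_tick]
      omega

/-- A bound for the time that the scan of the stack `l` takes. -/
def work (adj : Fin n → List (Fin n)) (l : List (Fin n × Bool)) : ℕ :=
  8 * l.length + ((ins l).map fun v => 12 * (1 + (adj v).length)).sum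

lemma exists_split {α : Type*} {l : List α} {i : ℕ} (h : i < l.length) :
    ∃ l₁ a l₂, l = l₁ ++ a :: l₂ ∧ l₂.length = i := by
  refine ⟨l.take (l.length - 1 - i), l[l.length - 1 - i], l.drop (l.length - i), ?_, ?_⟩
  · conv_lhs => rw [← List.take_append_drop (l.length - 1 - i) l]
    rw [List.drop_eq_getElem_cons (by omega)]
    congr 3
    omega
  · simp
    omega

/-- The cell read in the scan of the stack. -/
lemma Store.get {mem : ℕ → ℕ} {l₁ l₂ : List (Fin n × Bool)} {p : Fin n × Bool}
    (h : Store adj mem b (l₁ ++ p :: l₂) F) : mem (inputSize adj + l₂.length) = p.1 := by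
  have := h.stack
  rw [keys, List.map_append, List.map_cons] at this
  simpa using this.append

/-- The greedy extension either reaches the limit or ends with a closed stack. -/
lemma run_extend (hR : Room adj S W b) (hC : Config adj s b l F)
    (hlim : (ins l).length ≤ s.reg rLim) :
    Run S W extendProg s fun t => ∃ E, Config adj t b (push E l) F ∧
      (ins (push E l)).length ≤ s.reg rLim ∧
      ((ins (push E l)).length < s.reg rLim → Closed adj (push E l) F) ∧
      Frame adj b rY s t ∧ t.clock ≤ s.clock + 2 + work adj (push E l) := by
  have h1 := hR.above
  have h2 := hR.le
  have h3 := hR.lt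
  simp only [extendProg, run_seq, run_assign, val_lit]
  refine ⟨by omega, ?_⟩
  refine run_loop (fun m t => ∃ E l₁ l₂, push E l = l₁ ++ l₂ ∧ l₂.length + m = n ∧
    Config adj t b (push E l) F ∧ (ins (push E l)).length ≤ s.reg rLim ∧
    ((ins (push E l)).length < s.reg rLim →
      ∀ v ∈ ins l₂, ∀ w ∈ adj v, w ∈ keys (push E l) ∨ w ∈ F) ∧
    t.reg rI = l₂.length ∧ Frame adj b rY s t ∧ t.clock ≤ s.clock + 1 + work adj l₂)
    (m := n) ?_ ?_ ?_
  · refine ⟨[], l, [], by simp, by simp, ⟨hC.store, ?_, ?_, ?_, ?_⟩, hlim, ?_, ?_, ?_, ?_⟩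
    any_goals simp [hC.regL, hC.regStat, hC.regD, hC.regCount, work]
    repeat first
      | exact Frame.rfl
      | apply Frame.tick
      | refine Frame.setReg ?_ (by norm_num)
  · rintro m t ⟨E, l₁, l₂, hsplit, hm, hC', hlim', hdone, hI, hF, hclock⟩ hlt
    simp only [holds_lt, val_reg, hI, hC'.regD] at hlt
    obtain ⟨l₁, p, l₃, h4, h5⟩ := exists_split hlt
    obtain ⟨-, rfl⟩ : l₁ ++ [p] = _ ∧ l₃ = l₂ :=
      List.append_inj' (by rw [List.append_assoc, List.singleton_append, ← h4, hsplit]) h5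
    have hp : p ∈ push E l := by rw [h4]; simp
    have h6 : t.mem (inputSize adj + l₃.length) = p.1 := by
      have := hC'.store
      rw [h4] at this
      exact this.get
    have h7 := hC'.store.stat p.1
    have h8 := hC'.store.length_le
    have h9 := status_le (push E l) F p.1
    have h10 := p.1.2
    have hL : t.reg rLim = s.reg rLim := hF.reg _ (by norm_num)
    simp only [run_seq, run_load, run_add, run_cond, run_skip, val_reg, val_lit, reg_tick,
      reg_setReg, mem_tick, mem_setReg, holds_eq, Function.update_self, ne_eq,
      not_false_eq_true, Function.update_of_ne, Nat.reduceEqDiff, hC'.regL, hC'.regStat, hI, h6, h7]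
    refine ⟨by omega, by omega, by omega, by omega, by omega, by omega, fun hst => ?_,
      fun hst => ?_⟩
    · rw [status_eq_one] at hst
      obtain ⟨v, rfl⟩ : ∃ v, p = (v, true) := by
        rcases p with ⟨v, _ | _⟩
        · exact absurd hst (notMem_ins_of_mem_outs hC'.store.nodup_keys (mem_outs.2 hp))
        · exact ⟨v, rfl⟩
      refine Run.mono (run_scan hR (l := push E l) (F := F) (v := v) ?_ ?_ ?_ hst) ?_
      · exact ⟨hC'.store, by simp [hC'.regL], by simp [hC'.regStat], by simp [hC'.regD],
          by simp [hC'.regCount]⟩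
      · simpa [hL] using hlim'
      · simp
      · rintro u ⟨E', hu, hlim'', hw, huI, hF', hclock'⟩
        simp only [reg_tick, reg_setReg, ne_eq, not_false_eq_true, Function.update_of_ne,
          Nat.reduceEqDiff, hL, hI, clock_tick, clock_setReg] at hlim'' hw huI hclock'
        rw [push_push] at hu hlim'' hw
        refine ⟨by omega, m - 1, by omega, E' ++ E, push E' l₁,
          (v, true) :: l₃, ?_, ?_, ⟨hu.store, ?_, ?_, ?_, ?_⟩, hlim'', ?_, ?_, ?_, ?_⟩
        any_goals simp [hu.regL, hu.regStat, hu.regD, hu.regCount, huI]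
        · rw [← push_push, h4, push_append]
        · omega
        · simp only [ins_push, keys_push, List.length_append, List.mem_append] at hw hdone ⊢
          refine fun hlt' => ⟨fun w hw' => by
            simpa [or_assoc] using hw (by simpa [add_assoc] using hlt') w hw', ?_⟩
          intro v hv w hw'
          have := hdone (by omega) v hv w hw'
          tauto
        · refine Frame.tick (Frame.setReg (hF.trans (Frame.trans ?_ hF')) (by norm_num))
          repeat first
            | exact Frame.rfl
            | apply Frame.tick
            | refine Frame.setReg ?_ (by norm_num)
        · simp only [work, ins_cons_true, List.map_cons, List.sum_cons, List.length_cons]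
            at hclock ⊢
          omega
    · rw [status_eq_one] at hst
      obtain ⟨v, rfl⟩ : ∃ v, p = (v, false) := by
        rcases p with ⟨v, _ | _⟩
        · exact ⟨v, rfl⟩
        · exact absurd (mem_ins.2 hp) hst
      refine ⟨by omega, m - 1, by omega, E, l₁, (v, false) :: l₃, h4, by simp; omega,
        ⟨hC'.store, ?_, ?_, ?_, ?_⟩, hlim', hdone, ?_, ?_, ?_⟩
      any_goals simp [hC'.regL, hC'.regStat, hC'.regD, hC'.regCount]
      · refine hF.trans ?_
        repeat first
          | exact Frame.rfl
          | apply Frame.tick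
          | refine Frame.setReg ?_ (by norm_num)
      · simp only [work, ins_cons_false, List.length_cons] at hclock ⊢
        omega
  · rintro m t ⟨E, l₁, l₂, hsplit, hm, hC', hlim', hdone, hI, hF, hclock⟩ hlt
    simp only [holds_lt, val_reg, hI, hC'.regD, hsplit, List.length_append, not_lt] at hlt
    obtain rfl : l₁ = [] := List.eq_nil_of_length_eq_zero (by omega)
    rw [List.nil_append] at hsplit
    subst hsplit
    refine ⟨E, ⟨hC'.store, hC'.regL, hC'.regStat, hC'.regD, hC'.regCount⟩, hlim', hdone,
      hF.tick, ?_⟩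
    simp only [clock_tick]
    omega

end

section

variable {n : ℕ} {adj : Fin n → List (Fin n)} {b : ℕ} {l : List (Fin n × Bool)}
  {F : List (Fin n)} {S W : ℕ} {s : State}

lemma work_le {D : ℕ} (hD : ∀ v, (adj v).length ≤ D) (l : List (Fin n × Bool)) :
    work adj l ≤ 8 * l.length + (ins l).length * (12 * (1 + D)) := by
  have := List.sum_le_card_nsmul ((ins l).map fun v => 12 * (1 + (adj v).length)) (12 * (1 + D))
    (by
      simp only [List.mem_map, forall_exists_index, and_imp, forall_apply_eq_imp_iff₂]
      intro v _
      have := hD v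
      omega)
  rw [List.length_map, smul_eq_mul] at this
  simp only [work]
  omega

lemma work_le_sum (h : (keys l).Nodup) :
    work adj l ≤ 20 * ∑ v : Fin n, (1 + (adj v).length) := by
  have h1 : l.length ≤ n := by simpa using h.length_le_card
  have h2 : ((ins l).map fun v => 12 * (1 + (adj v).length)).sum ≤
      ∑ v : Fin n, 12 * (1 + (adj v).length) := by
    rw [← List.sum_toFinset _ (nodup_ins h)]
    exact Finset.sum_le_sum_of_subset (Finset.subset_univ _)
  have h3 : n ≤ ∑ v : Fin n, (1 + (adj v).length) := by
    simp [Finset.sum_add_distrib]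
  rw [← Finset.mul_sum] at h2
  simp only [work]
  omega

/-! ### Output and backtracking -/

lemma run_emit_stack (hR : Room adj S W b) (hC : Config adj s b l F) (hbuf : s.buf = []) :
    Run S W emitProg s fun t => t.mem = s.mem ∧ (∀ r, r ≤ rCount ∨ rY < r → t.reg r = s.reg r) ∧
      t.buf = [] ∧ t.out = s.out ++ [(t.clock, (ins l).reverse.map Fin.val)] ∧
      t.clock ≤ s.clock + 3 + 8 * l.length := by
  have h1 := hR.above
  have h2 := hR.le
  have h3 := hR.lt
  have h8 := hC.store.length_le
  simp only [emitProg, run_seq, run_assign, val_lit]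
  refine ⟨by omega, ?_⟩
  refine run_loop (fun m t => ∃ l₁ l₂, l = l₁ ++ l₂ ∧ l₁.length = m ∧
    t.mem = s.mem ∧ (∀ r, r ≤ rCount ∨ rY < r → t.reg r = s.reg r) ∧ t.reg rI = l₂.length ∧
    t.buf = (ins l₂).reverse.map Fin.val ∧ t.out = s.out ∧
    t.clock ≤ s.clock + 1 + 8 * l₂.length) (m := l.length) ?_ ?_ ?_
  · refine ⟨l, [], by simp, rfl, rfl, ?_, by simp, by simp [hbuf], rfl, by simp⟩
    intro r hr
    simp only [reg_tick, reg_setReg]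
    exact Function.update_of_ne (by omega) _ _
  · rintro m t ⟨l₁, l₂, hsplit, hm, hmem, hreg, hI, hb, ho, hclock⟩ hlt
    have hD : t.reg rD = l.length := (hreg _ (by norm_num)).trans hC.regD
    have hL : t.reg rL = inputSize adj := (hreg _ (by norm_num)).trans hC.regL
    have hSt : t.reg rStat = b := (hreg _ (by norm_num)).trans hC.regStat
    simp only [holds_lt, val_reg, hI, hD] at hlt
    obtain ⟨l₁', p, l₃, h4, h5⟩ := exists_split hlt
    obtain ⟨rfl, rfl⟩ : l₁' ++ [p] = l₁ ∧ l₃ = l₂ :=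
      List.append_inj' (by rw [List.append_assoc, List.singleton_append, ← h4, hsplit]) h5
    have hp : p ∈ l := by rw [h4]; simp
    have h6 : s.mem (inputSize adj + l₃.length) = p.1 := by
      have := hC.store
      rw [h4] at this
      exact this.get
    have h7 := hC.store.stat p.1
    have h9 := status_le l F p.1
    have h10 := p.1.2
    simp only [run_seq, run_load, run_add, run_cond, run_skip, run_emit, val_reg, val_lit,
      reg_tick, reg_setReg, reg_write, mem_tick, mem_setReg, holds_eq, Function.update_self, ne_eq,
      not_false_eq_true, Function.update_of_ne, Nat.reduceEqDiff, hL, hSt, hI, hmem, h6, h7]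
    refine ⟨by omega, by omega, by omega, by omega, by omega, by omega, fun hst => ?_,
      fun hst => ?_⟩
    · rw [status_eq_one] at hst
      obtain ⟨v, rfl⟩ : ∃ v, p = (v, true) := by
        rcases p with ⟨v, _ | _⟩
        · exact absurd hst (notMem_ins_of_mem_outs hC.store.nodup_keys (mem_outs.2 hp))
        · exact ⟨v, rfl⟩
      refine ⟨by omega, by omega, l₁'.length, by simp at hm; omega, l₁', _, h4, rfl, hmem, ?_,
        by simp, by simp [hb], by simp [ho], by simp; omega⟩
      intro r hr
      iterate 5 rw [Function.update_of_ne (by omega)]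
      exact hreg r hr
    · rw [status_eq_one] at hst
      obtain ⟨v, rfl⟩ : ∃ v, p = (v, false) := by
        rcases p with ⟨v, _ | _⟩
        · exact ⟨v, rfl⟩
        · exact absurd (mem_ins.2 hp) hst
      refine ⟨by omega, l₁'.length, by simp at hm; omega, l₁', _, h4, rfl, trivial, ?_,
        by simp, by simp [hb], by simp [ho], by simp; omega⟩
      intro r hr
      iterate 5 rw [Function.update_of_ne (by omega)]
      exact hreg r hr
  · rintro m t ⟨l₁, l₂, hsplit, hm, hmem, hreg, hI, hb, ho, hclock⟩ hlt
    have hD : t.reg rD = l.length := (hreg _ (by norm_num)).trans hC.regD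
    simp only [holds_lt, val_reg, hI, hD, hsplit, List.length_append, not_lt] at hlt
    obtain rfl : l₁ = [] := List.eq_nil_of_length_eq_zero (by omega)
    rw [List.nil_append] at hsplit
    subst hsplit
    rw [run_flush]
    refine ⟨hmem, hreg, rfl, by simp [ho, hb], ?_⟩
    simp only [clock_complete, clock_tick]
    omega

lemma run_pop {p : Fin n × Bool} {Q : State → Prop} (hR : Room adj S W b)
    (hS : Store adj s.mem b (p :: l) F) (hL : s.reg rL = inputSize adj) (hSt : s.reg rStat = b)
    (hD : s.reg rD = l.length + 1)
    (hQ : Q ((((s.setReg rD l.length).tick.setReg rX (inputSize adj + l.length)).tick.setReg rV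
      p.1).tick.setReg rX (b + p.1)).tick) : Run S W popProg s Q := by
  have h1 := hR.above
  have h2 := hR.le
  have h3 := hR.lt
  have h4 := hS.length_le
  have h5 : s.mem (inputSize adj + l.length) = p.1 := Store.get (l₁ := []) hS
  have h6 := p.1.2
  rw [List.length_cons] at h4
  simp only [popProg, run_seq, run_load, run_add, run_sub, val_reg, val_lit,
      reg_tick, reg_setReg, mem_tick, mem_setReg, Function.update_self, ne_eq,
      not_false_eq_true, Function.update_of_ne, Nat.reduceEqDiff, hL, hSt, hD, h5,
      Nat.add_sub_cancel]
  exact ⟨by omega, by omega, by omega, by omega, by omega, hQ⟩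

/-- Removing the vertices `l₁` from the stack and freeing them. -/
lemma run_undo (hR : Room adj S W b) {l₁ : List (Fin n × Bool)}
    (hS : Store adj s.mem b (l₁ ++ l) F) (hL : s.reg rL = inputSize adj) (hSt : s.reg rStat = b)
    (hD : s.reg rD = (l₁ ++ l).length) (hD0 : s.reg rD0 = l.length) :
    Run S W (.loop (.lt ®rD0 ®rD) (popProg ;; .store ®rX §0)) s fun t =>
      Store adj t.mem b l F ∧ t.reg rD = l.length ∧ t.reg rCount = s.reg rCount ∧
      Frame adj b rY s t ∧ t.clock ≤ s.clock + 1 + 6 * l₁.length := by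
  have h2 := hR.le
  have h3 := hR.lt
  refine run_loop (fun m t => ∃ l₂, l₂.length = m ∧ Store adj t.mem b (l₂ ++ l) F ∧
    t.reg rD = (l₂ ++ l).length ∧ t.reg rCount = s.reg rCount ∧ Frame adj b rY s t ∧
    t.clock + 6 * l₂.length ≤ s.clock + 6 * l₁.length) (m := l₁.length) ?_ ?_ ?_
  · exact ⟨l₁, rfl, hS, hD, rfl, Frame.rfl, le_rfl⟩
  · rintro m t ⟨l₂, hm, hS', hD', hc, hF, hclock⟩ hlt
    have hD0' : t.reg rD0 = l.length := (hF.reg _ (by norm_num)).trans hD0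
    have hL' : t.reg rL = inputSize adj := (hF.reg _ (by norm_num)).trans hL
    have hSt' : t.reg rStat = b := (hF.reg _ (by norm_num)).trans hSt
    simp only [holds_lt, val_reg, hD0', hD', List.length_append] at hlt
    obtain ⟨p, l₂, rfl⟩ : ∃ p l₃, l₂ = p :: l₃ := by
      cases l₂ with
      | nil => simp at hlt
      | cons p l₃ => exact ⟨p, l₃, rfl⟩
    rw [run_seq]
    refine run_pop (s := t.tick) (p := p) (l := l₂ ++ l) hR hS' hL' hSt' (by simp [hD']) ?_
    have h6 := p.1.2
    simp only [run_store, val_reg, val_lit, reg_tick, reg_setReg, Function.update_self]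
    refine ⟨by omega, by omega, l₂.length, by simp at hm; omega, l₂, rfl, ?_, ?_, ?_, ?_, ?_⟩
    · exact hS'.popTop hR.above
    · simp
    · simpa using hc
    · refine hF.trans ?_
      have := hS'.length_le
      repeat first
        | exact Frame.rfl
        | apply Frame.tick
        | refine Frame.setReg ?_ (by norm_num)
        | refine Frame.setStat ?_ _
    · simp at hclock ⊢
      omega
  · rintro m t ⟨l₂, hm, hS', hD', hc, hF, hclock⟩ hlt
    have hD0' : t.reg rD0 = l.length := (hF.reg _ (by norm_num)).trans hD0
    simp only [holds_lt, val_reg, hD0', hD', List.length_append] at hlt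
    obtain rfl : l₂ = [] := List.eq_nil_of_length_eq_zero (by omega)
    refine ⟨hS', hD', hc, hF.tick, ?_⟩
    simp at hclock ⊢
    omega

end

section

variable {n : ℕ} {adj : Fin n → List (Fin n)} {b : ℕ} {l : List (Fin n × Bool)}
  {F : List (Fin n)} {S W : ℕ} {s t : State} {k : ℕ} {G : SimpleGraph (Fin n)}

/-- The state of the enumeration phase: the search stack is `l`, the stack of the roots to come is
`F`. -/
structure Search (adj : Fin n → List (Fin n)) (k : ℕ) (s : State) (b : ℕ)
    (l : List (Fin n × Bool)) (F : List (Fin n)) : Prop where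
  config : Config adj s b l F
  count : (ins l).length ≤ k
  regN : s.reg rN = n
  regK : s.reg rK = k
  regLim : s.reg rLim = k
  regRoots : s.reg rRoots = b + n
  regT : s.reg rT = F.length
  roots : StackAt s.mem (b + n) F
  buf : s.buf = []

lemma Search.of_frame {l' : List (Fin n × Bool)} (h : Search adj k s b l F)
    (hb : inputSize adj + n ≤ b) (hF : Frame adj b rCount0 s t)
    (hC : Config adj t b l' F) (hc : (ins l').length ≤ k) : Search adj k t b l' F where
  config := hC
  count := hc
  regN := (hF.reg _ (by norm_num)).trans h.regN
  regK := (hF.reg _ (by norm_num)).trans h.regK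
  regLim := (hF.reg _ (by norm_num)).trans h.regLim
  regRoots := (hF.reg _ (by norm_num)).trans h.regRoots
  regT := (hF.reg _ (by norm_num)).trans h.regT
  roots := h.roots.congr fun i _ => hF.mem _ (by omega) (by omega)
  buf := hF.buf.trans h.buf

lemma Search.congr (h : Search adj k s b l F) (hm : t.mem = s.mem)
    (hr : ∀ r, r ≤ rCount ∨ r = rT → t.reg r = s.reg r) (hb : t.buf = []) :
    Search adj k t b l F where
  config := ⟨by rw [hm]; exact h.config.store, (hr _ (by norm_num)).trans h.config.regL,
    (hr _ (by norm_num)).trans h.config.regStat, (hr _ (by norm_num)).trans h.config.regD,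
    (hr _ (by norm_num)).trans h.config.regCount⟩
  count := h.count
  regN := (hr _ (by norm_num)).trans h.regN
  regK := (hr _ (by norm_num)).trans h.regK
  regLim := (hr _ (by norm_num)).trans h.regLim
  regRoots := (hr _ (by norm_num)).trans h.regRoots
  regT := (hr _ (by norm_num)).trans h.regT
  roots := by rw [hm]; exact h.roots
  buf := hb

lemma Search.tick (h : Search adj k s b l F) : Search adj k s.tick b l F :=
  h.congr rfl (fun _ _ => rfl) h.buf

/-- The set of solutions that exclude one more vertex is empty if `k ≥ n`. -/
lemma sol_eq_empty_of_le (hk : n ≤ k) (u : Fin n) : Sol G k ((u, false) :: l) F = ∅ := by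
  rw [Set.eq_empty_iff_forall_notMem]
  rintro X ⟨hX, -, ho, -⟩
  have h1 : X.card < n := by
    have : X ⊂ Finset.univ := by
      rw [Finset.ssubset_univ_iff]
      rintro rfl
      exact ho u (by simp) (Finset.mem_univ u)
    simpa using Finset.card_lt_card this
  have := hX.1
  omega

/-- The attempt to exclude the vertex `u`, which has just been popped. -/
lemma run_try (hadj : IsAdjacencyList G adj) (hR : Room adj S W b) {u : Fin n}
    (hS : Store adj s.mem b ((u, true) :: l) F) (hl : l ≠ []) (hL : s.reg rL = inputSize adj)
    (hSt : s.reg rStat = b) (hD : s.reg rD = l.length) (hC : s.reg rCount = (ins l).length)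
    (hK : s.reg rK = k) (hLim : s.reg rLim = k) (hX : s.reg rX = b + u) (hk : (ins l).length < k)
    {D : ℕ} (hdeg : ∀ v, (adj v).length ≤ D) :
    Run S W tryProg s fun t => Frame adj b rCount0 s t ∧
      t.clock ≤ s.clock + 8 * l.length + k * (12 * (1 + D)) + 14 * k + 23 ∧
      ((Config adj t b l F ∧ t.reg rRun = s.reg rRun ∧ Sol G k ((u, false) :: l) F = ∅) ∨
        ∃ E, Config adj t b (push E ((u, false) :: l)) F ∧ t.reg rRun = 0 ∧
          (ins (push E ((u, false) :: l))).length = k) := by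
  have h1 := hR.above
  have h2 := hR.le
  have h3 := hR.lt
  have h4 := u.2
  have h5 := hS.flipTop h1 hl
  have h6 := h5.length_le
  have h7 := length_ins_le l
  rw [List.length_cons] at h6
  simp only [tryProg, run_seq, run_add, run_assign, run_store, val_reg, val_lit,
      reg_tick, reg_setReg, reg_setMem, ne_eq,
      not_false_eq_true, Function.update_of_ne, Nat.reduceEqDiff, hX, hD, hC]
  refine ⟨by omega, by omega, by omega, by omega, by omega, ?_⟩
  refine Run.mono (run_extend hR (l := (u, false) :: l) (F := F) ⟨h5, ?_, ?_, ?_, ?_⟩ ?_) ?_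
  any_goals simp only [reg_tick, reg_setReg, reg_setMem, ne_eq, not_false_eq_true,
    Function.update_of_ne, Function.update_self, Nat.reduceEqDiff, hL, hSt, hC, hLim,
    List.length_cons, ins_cons_false]
  · omega
  rintro t ⟨E, hCt, hlim, hclosed, hF, hclock⟩
  simp only [clock_tick, clock_setReg, clock_setMem] at hclock
  have hD0 : t.reg rD0 = l.length := (hF.reg _ (by norm_num)).trans (by simp)
  have hC0 : t.reg rCount0 = (ins l).length := (hF.reg _ (by norm_num)).trans (by simp)
  have hKt : t.reg rK = k := (hF.reg _ (by norm_num)).trans (by simp [hK])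
  have hRt : t.reg rRun = s.reg rRun := (hF.reg _ (by norm_num)).trans (by simp)
  have hFt : Frame adj b rCount0 s t := by
    refine Frame.trans ?_ (hF.mono (by norm_num))
    repeat first
      | exact Frame.rfl
      | apply Frame.tick
      | refine Frame.setReg ?_ (by norm_num)
      | refine Frame.setStat ?_ _
  have hw := work_le hdeg (push E ((u, false) :: l))
  have hw' := Nat.mul_le_mul_right (12 * (1 + D)) hlim
  have hE : E.length ≤ k := by
    rw [ins_push, List.length_append] at hlim
    omega
  rw [length_push, List.length_cons] at hw
  rw [run_cond]
  refine ⟨fun hcond => ?_, fun hcond => ?_⟩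
  · simp only [holds_eq, val_reg, hCt.regCount, hKt] at hcond
    rw [run_assign]
    refine ⟨by simp only [val_lit]; omega, (hFt.tick.setReg (by norm_num)).tick, ?_,
      Or.inr ⟨E, ⟨hCt.store, ?_, ?_, ?_, ?_⟩, ?_, hcond⟩⟩
    · simp only [clock_tick, clock_setReg]
      omega
    · simp [hCt.regL]
    · simp [hCt.regStat]
    · simp [hCt.regD]
    · simp [hCt.regCount]
    · simp
  · simp only [holds_eq, val_reg, hCt.regCount, hKt] at hcond
    have hlt := lt_of_le_of_ne hlim hcond
    simp only [run_seq, run_assign, val_reg, reg_tick, hC0]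
    refine ⟨by omega, ?_⟩
    refine Run.mono (run_undo (l := l) (l₁ := push E [(u, false)]) (F := F) hR ?_ ?_ ?_ ?_ ?_) ?_
    any_goals simp only [reg_tick, reg_setReg, ne_eq, not_false_eq_true,
      Function.update_of_ne, Function.update_self, Nat.reduceEqDiff, hCt.regL, hCt.regStat,
      hCt.regD, hD0, mem_tick, mem_setReg, ← push_append, List.singleton_append]
    · exact hCt.store
    · rintro v ⟨hSv, hDv, hCv, hFv, hclockv⟩
      simp only [clock_tick, clock_setReg, length_push, List.length_singleton] at hclockv
      have hFv' : Frame adj b rY t v :=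
        ((Frame.rfl.tick.setReg (by norm_num)).tick).trans hFv
      refine ⟨hFt.trans (hFv'.mono (by norm_num)), by omega, Or.inl ⟨⟨hSv, ?_, ?_, hDv, hCv⟩,
        (hFv'.reg _ (by norm_num)).trans hRt, ?_⟩⟩
      · exact (hFv'.reg _ (by norm_num)).trans hCt.regL
      · exact (hFv'.reg _ (by norm_num)).trans hCt.regStat
      · exact sol_eq_empty hadj h5.linked (by simp) hCt.store.nodup_keys (hclosed hlt) hlt

/-- One step of backtracking takes time at most `T`, where only the case `k < n` requires that `T`
covers the time of an extension. It drops the top of the stack and keeps the solutions to be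
found, or it reaches the next solution, or it removes the root. -/
lemma run_back (hadj : IsAdjacencyList G adj) (hR : Room adj S W b) {p : Fin n × Bool}
    (hS : Search adj k s b (p :: l) F) (hrun : s.reg rRun = 1)
    {D T : ℕ} (hdeg : ∀ v, (adj v).length ≤ D) (hT : 12 ≤ T)
    (hT' : k < n → 8 * l.length + k * (12 * (1 + D)) + 14 * k + 40 ≤ T) :
    Run S W backProg s fun t => t.clock ≤ s.clock + T ∧ t.out = s.out ∧
      ((t.reg rRun = 1 ∧ l ≠ [] ∧ Search adj k t b l F ∧ Rem G k F (p :: l) = Rem G k F l) ∨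
        (t.reg rRun = 0 ∧ l = [] ∧ Search adj k t b [] F) ∨
        (t.reg rRun = 0 ∧ k < n ∧ ∃ l', l' ≠ [] ∧ Search adj k t b l' F ∧ (ins l').length = k ∧
          Rem G k F (p :: l) = Sol G k l' F ∪ Rem G k F l')) := by
  have h1 := hR.above
  have h2 := hR.le
  have h3 := hR.lt
  have hC := hS.config
  have hst := hC.store.stat p.1
  have hp := p.1.2
  have hle := hC.store.length_le
  have hins := length_ins_le l
  have hcount := hS.count
  rw [List.length_cons] at hle
  rw [backProg, run_seq]
  refine run_pop hR hC.store hC.regL hC.regStat hC.regD ?_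
  have hF0 : Frame adj b rCount0 s ((((s.setReg rD l.length).tick.setReg rX
      (inputSize adj + l.length)).tick.setReg rV p.1).tick.setReg rX (b + p.1)).tick := by
    repeat first
      | exact Frame.rfl
      | apply Frame.tick
      | refine Frame.setReg ?_ (by norm_num)
  have hst2 := status_le (p :: l) F p.1
  simp only [run_seq, run_load, run_cond, run_assign, run_sub, run_store, val_reg, val_lit,
      reg_tick, reg_setReg, mem_tick, mem_setReg, reg_setMem, holds_eq, holds_lt, ne_eq,
      Function.update_self,
      not_false_eq_true, Function.update_of_ne, Nat.reduceEqDiff, hst]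
  refine ⟨by omega, by omega, fun h => ?_, fun h => ?_⟩
  · obtain ⟨u, rfl⟩ : ∃ u, p = (u, false) := by
      rcases p with ⟨u, _ | _⟩
      · exact ⟨u, rfl⟩
      · simp [status] at h
    have hl : l ≠ [] := by
      rintro rfl
      rcases hC.store.linked.1 with ⟨-, h⟩ | ⟨q, hq, -⟩
      · simp at h
      · simp at hq
    refine ⟨by omega, by omega, by simp; omega, by simp, Or.inl ⟨by simp [hrun], hl,
      hS.of_frame h1 ((hF0.setReg (by norm_num)).tick.tick.setStat _).tick
        ⟨hC.store.popTop h1, ?_, ?_, ?_, ?_⟩ hcount, rem_cons_false u hl⟩⟩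
    all_goals simp [hC.regL, hC.regStat, hC.regCount]
  · obtain ⟨u, rfl⟩ : ∃ u, p = (u, true) := by
      rcases p with ⟨u, _ | _⟩
      · have := notMem_ins_of_mem_outs hC.store.nodup_keys (v := u) (by simp)
        simp [status] at h this
        exact absurd h this
      · exact ⟨u, rfl⟩
    have hCount : s.reg rCount - 1 = (ins l).length := by simp [hC.regCount]
    simp only [ins_cons_true, List.length_cons] at hcount
    simp only [hS.regK, hS.regN, hCount]
    have hF1 := (((hF0.setReg (r := rY) (x := status ((u, true) :: l) F u)
      (by norm_num)).tick.tick).setReg (r := rCount) (x := (ins l).length)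
      (by norm_num)).tick.tick
    refine ⟨by omega, fun h0 => ?_, fun h0 => ⟨fun hkn => ?_, fun hkn => ?_⟩⟩
    · obtain rfl : l = [] := List.eq_nil_of_length_eq_zero h0
      refine ⟨by omega, by omega, by omega, by simp; omega, by simp, Or.inr (Or.inl ⟨by simp, rfl,
        hS.of_frame h1 (((hF1.setStat u).tick).setReg (by norm_num)).tick
        ⟨hC.store.popTop h1, ?_, ?_, ?_, ?_⟩ (by simp)⟩)⟩
      all_goals simp [hC.regL, hC.regStat]
    · have hl : l ≠ [] := by rintro rfl; simp at h0
      refine Run.mono (run_try hadj hR (u := u) (k := k) (l := l) (F := F) ?_ hl ?_ ?_ ?_ ?_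
        ?_ ?_ ?_ ?_ hdeg) ?_
      · exact hC.store
      any_goals simp [hC.regL, hC.regStat, hS.regLim, hS.regK]
      · omega
      · intro t hFt hclock hpost
        have hF2 := hF1.tick.trans hFt
        have ht : t.out = s.out := hF2.out
        have := hT' hkn
        refine ⟨by omega, ht, ?_⟩
        rcases hpost with ⟨hCt, hrt, hsol⟩ | ⟨E, hCt, hrt, hk⟩
        · refine Or.inl ⟨hrt.trans hrun, hl, hS.of_frame h1 hF2 hCt (by omega), ?_⟩
          rw [rem_cons_true u hl, hsol, Set.empty_union]
        · replace hk : (ins (push E ((u, false) :: l))).length = k := by simpa using hk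
          refine Or.inr (Or.inr ⟨hrt, hkn, push E ((u, false) :: l), by simp [push],
            hS.of_frame h1 hF2 hCt hk.le, hk, ?_⟩)
          rw [sol_union_rem_push E (by simp), rem_cons_true u hl, rem_cons_false u hl]
    · have hl : l ≠ [] := by rintro rfl; simp at h0
      refine ⟨by omega, by omega, by simp; omega, by simp, Or.inl ⟨by simp [hrun], hl,
        hS.of_frame h1 ((hF1.tick.setStat u).tick)
        ⟨hC.store.popTop h1, ?_, ?_, ?_, ?_⟩ (by omega), ?_⟩⟩
      any_goals simp [hC.regL, hC.regStat]
      rw [rem_cons_true u hl, sol_eq_empty_of_le (by omega), Set.empty_union]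

end

section

variable {n : ℕ} {adj : Fin n → List (Fin n)} {b : ℕ} {l : List (Fin n × Bool)}
  {F : List (Fin n)} {S W : ℕ} {s t : State} {k : ℕ} {G : SimpleGraph (Fin n)}

/-! ### The record of the outputs -/

/-- The time of the last output, or `0` if there is none. -/
def lastTime (out : List (ℕ × List ℕ)) : ℕ := (out.map Prod.fst).getLastD 0

/-- The first output comes at time `B₀` at the latest, and the delay is at most `B`. -/
def Timely (B₀ B : ℕ) (out : List (ℕ × List ℕ)) : Prop :=
  out.IsChain (fun a b => b.1 ≤ a.1 + B) ∧ ∀ o ∈ out.head?, o.1 ≤ B₀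

/-- The latest time for the next output. -/
def deadline (B₀ B : ℕ) (out : List (ℕ × List ℕ)) : ℕ :=
  if out = [] then B₀ else lastTime out + B

/-- The sets written so far are different, and they are the connected `k`-sets outside `A`. -/
def Progress (G : SimpleGraph (Fin n)) (k : ℕ) (out : List (ℕ × List ℕ))
    (A : Set (Finset (Fin n))) : Prop :=
  ∃ L : List (Finset (Fin n)),
    out.map (fun o => o.2.toFinset) = L.map (fun X => X.map Fin.valEmbedding) ∧
    (∀ o ∈ out, o.2.Nodup) ∧ L.Nodup ∧ (∀ X, X ∈ connectedSets G k ↔ X ∈ L ∨ X ∈ A) ∧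
    ∀ X ∈ L, X ∉ A

@[simp] lemma lastTime_append (out : List (ℕ × List ℕ)) (c : ℕ) (w : List ℕ) :
    lastTime (out ++ [(c, w)]) = c := by simp [lastTime]

lemma Timely.append {B₀ B : ℕ} {out : List (ℕ × List ℕ)} (h : Timely B₀ B out) {c : ℕ}
    {w : List ℕ} (hc : c ≤ deadline B₀ B out) : Timely B₀ B (out ++ [(c, w)]) := by
  unfold deadline at hc
  split_ifs at hc with h0
  · subst h0
    exact ⟨List.isChain_singleton _, by simpa using hc⟩
  · obtain ⟨out', o, rfl⟩ : ∃ out' o, out = out' ++ [o] :=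
      ⟨_, _, (List.dropLast_append_getLast h0).symm⟩
    refine ⟨List.isChain_append.2 ⟨h.1, List.isChain_singleton _, ?_⟩, ?_⟩
    · simpa [lastTime] using hc
    · intro o' ho'
      refine h.2 o' ?_
      cases out' <;> simpa using ho'

/-- Writing the only solution below a stack. The stack is written from its bottom to its top. -/
lemma Progress.append {out : List (ℕ × List ℕ)} {A : Set (Finset (Fin n))} {l : List (Fin n)}
    (h : Progress G k out ({l.toFinset} ∪ A)) (hA : l.toFinset ∉ A) (hl : l.Nodup) (c : ℕ) :
    Progress G k (out ++ [(c, l.reverse.map Fin.val)]) A := by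
  obtain ⟨L, h1, h2, h3, h4, h5⟩ := h
  refine ⟨L ++ [l.toFinset], ?_, ?_, ?_, ?_, ?_⟩
  · rw [List.map_append, List.map_append, h1]
    congr 1
    simp only [List.map_cons, List.map_nil, List.cons.injEq, and_true]
    ext x
    simp
  · simp only [List.mem_append, List.mem_singleton]
    rintro o (ho | rfl)
    · exact h2 o ho
    · exact (List.nodup_reverse.2 hl).map Fin.val_injective
  · rw [List.nodup_append]
    refine ⟨h3, List.nodup_singleton _, fun X hX Y hY => ?_⟩
    rintro rfl
    exact h5 X hX (Or.inl (by simpa using hY))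
  · intro X
    rw [h4 X]
    simp only [Set.mem_union, Set.mem_singleton_iff, List.mem_append, List.mem_singleton]
    tauto
  · simp only [List.mem_append, List.mem_singleton]
    rintro X (hX | rfl)
    · exact fun hX' => h5 X hX (Or.inr hX')
    · exact hA

lemma Progress.length_le {out : List (ℕ × List ℕ)} {A : Set (Finset (Fin n))}
    (h : Progress G k out A) : out.length ≤ 2 ^ n := by
  obtain ⟨L, h1, -, h3, -⟩ := h
  have h6 := congrArg List.length h1
  rw [List.length_map, List.length_map] at h6
  rw [h6]
  simpa using h3.length_le_card

/-! ### The enumeration phase -/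

/-- A bound for the length of a search stack with `k` included vertices in a graph of maximum
degree `D`. -/
def stackBound (n k D : ℕ) : ℕ := k + min (n - k) (k * D)

lemma length_le_stackBound (hL : Linked adj l) (hn : (keys l).Nodup) {D : ℕ}
    (hD : ∀ v, (adj v).length ≤ D) (hk : (ins l).length = k) : l.length ≤ stackBound n k D := by
  have h1 := length_ins_add_length_outs l
  have h2 := hL.length_outs_le hn hD
  have h3 : l.length ≤ n := by simpa using hn.length_le_card
  rw [hk] at h1 h2
  have h4 : (outs l).length ≤ min (n - k) (k * D) := le_min (by omega) h2
  unfold stackBound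
  omega

/-- Time bounds for the enumeration: `T` for one step of backtracking, `B₀` for the first output,
`B` for the delay. -/
structure Bounds (adj : Fin n → List (Fin n)) (k D T B₀ B : ℕ) : Prop where
  deg : ∀ v, (adj v).length ≤ D
  step : 12 ≤ T
  try_le : k < n → 8 * stackBound n k D + k * (12 * (1 + D)) + 14 * k + 40 ≤ T
  delay : k < n → stackBound n k D * (T + 1) + T + 8 * stackBound n k D + 20 ≤ B

variable {D T B₀ B : ℕ}

/-- Backtracking from the solution at stack `l`, which was written at time `τ`, to the next one.
Every step removes the top of the stack, until the last one finds a solution or removes the root. -/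
lemma run_next (hadj : IsAdjacencyList G adj) (hR : Room adj S W b) (hB : Bounds adj k D T B₀ B)
    (hS : Search adj k s b l F) (hl : l ≠ []) (hlen : l.length ≤ stackBound n k D)
    (hrun : s.reg rRun = 1) {τ : ℕ} (hclock : s.clock ≤ τ + 1) :
    Run S W (.loop (.eq ®rRun §1) backProg) s fun t =>
      t.clock ≤ τ + 2 + stackBound n k D * (T + 1) ∧ t.out = s.out ∧
      ((Search adj k t b [] F ∧ Rem G k F l = Rem G k F []) ∨
        (k < n ∧ ∃ l', l' ≠ [] ∧ Search adj k t b l' F ∧ (ins l').length = k ∧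
          Rem G k F l = Sol G k l' F ∪ Rem G k F l')) := by
  refine run_loop (fun m t => t.out = s.out ∧ ((t.reg rRun = 1 ∧ ∃ l', l' ≠ [] ∧ l'.length = m ∧
      m ≤ stackBound n k D ∧
      Search adj k t b l' F ∧ Rem G k F l = Rem G k F l' ∧
      t.clock + l'.length * (T + 1) ≤ τ + 1 + stackBound n k D * (T + 1)) ∨
      (t.reg rRun = 0 ∧ m = 0 ∧ t.clock ≤ τ + 1 + stackBound n k D * (T + 1) ∧
      ((Search adj k t b [] F ∧ Rem G k F l = Rem G k F []) ∨
        (k < n ∧ ∃ l', l' ≠ [] ∧ Search adj k t b l' F ∧ (ins l').length = k ∧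
          Rem G k F l = Sol G k l' F ∪ Rem G k F l'))))) (m := l.length) ?_ ?_ ?_
  · have := Nat.mul_le_mul_right (T + 1) hlen
    exact ⟨rfl, Or.inl ⟨hrun, l, hl, rfl, hlen, hS, rfl, by omega⟩⟩
  · rintro m t ⟨hout, ⟨hr, l', hl', hm, hmle, hS', hRem, hclk⟩ | ⟨hr, -⟩⟩ hc
    · obtain ⟨p, l', rfl⟩ := List.exists_cons_of_ne_nil hl'
      rw [List.length_cons] at hm
      rw [List.length_cons, add_mul, one_mul] at hclk
      refine Run.mono (run_back hadj hR hS'.tick hr hB.deg hB.step fun hkn => ?_) ?_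
      · have := hB.try_le hkn
        omega
      · rintro u ⟨hcu, hou, hu⟩
        rw [clock_tick] at hcu
        have hou' : u.out = s.out := hou.trans hout
        rcases hu with ⟨hru, hne, hSu, hRu⟩ | ⟨hru, rfl, hSu⟩ | ⟨hru, hkn, l₂, h2, hSu, h3, h4⟩
        · exact ⟨l'.length, by omega, hou', Or.inl ⟨hru, l', hne, rfl, by omega, hSu,
            hRem.trans hRu, by omega⟩⟩
        · exact ⟨0, by omega, hou', Or.inr ⟨hru, rfl, by omega, Or.inl ⟨hSu, hRem⟩⟩⟩
        · exact ⟨0, by omega, hou', Or.inr ⟨hru, rfl, by omega,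
            Or.inr ⟨hkn, l₂, h2, hSu, h3, hRem.trans h4⟩⟩⟩
    · simp [hr] at hc
  · rintro m t ⟨hout, ⟨hr, -⟩ | ⟨hr, -, hclk, ht⟩⟩ hc
    · simp [hr] at hc
    · refine ⟨by rw [clock_tick]; omega, hout, ?_⟩
      rcases ht with ⟨h1, h2⟩ | ⟨h1, l₂, h2, h3, h4, h5⟩
      · exact Or.inl ⟨h1.tick, h2⟩
      · exact Or.inr ⟨h1, l₂, h2, h3.tick, h4, h5⟩

/-- From a solution at stack `l`, found in time, all remaining solutions with the same root are
written in time. -/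
lemma run_solutions (hadj : IsAdjacencyList G adj) (hR : Room adj S W b)
    (hB : Bounds adj k D T B₀ B) (hS : Search adj k s b l F) (hl : l ≠ [])
    (hk : (ins l).length = k) (hout : Timely B₀ B s.out)
    (hprog : Progress G k s.out (Sol G k l F ∪ Rem G k F l))
    (hclock : s.clock + 4 + 8 * stackBound n k D ≤ deadline B₀ B s.out) :
    Run S W (.loop (.lt §0 ®rD) (emitProg ;; .assign rRun §1 ;; .loop (.eq ®rRun §1) backProg)) s
      fun t => Search adj k t b [] F ∧ Timely B₀ B t.out ∧ t.out ≠ [] ∧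
        Progress G k t.out (Rem G k F []) ∧
        t.clock ≤ lastTime t.out + stackBound n k D * (T + 1) + 3 := by
  have h3 := hR.lt
  -- The outputs are different sets, so that there are at most `2 ^ n` of them.
  refine run_loop (fun m t => m + t.out.length = 2 ^ n ∧ Timely B₀ B t.out ∧
    ((Search adj k t b [] F ∧ t.out ≠ [] ∧ Progress G k t.out (Rem G k F []) ∧
        t.clock ≤ lastTime t.out + stackBound n k D * (T + 1) + 2) ∨
      ∃ l, l ≠ [] ∧ (ins l).length = k ∧ Search adj k t b l F ∧
        Progress G k t.out (Sol G k l F ∪ Rem G k F l) ∧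
        t.clock + 4 + 8 * stackBound n k D ≤ deadline B₀ B t.out))
    (m := 2 ^ n - s.out.length) ?_ ?_ ?_
  · have := hprog.length_le
    exact ⟨by omega, hout, Or.inr ⟨l, hl, hk, hS, hprog, hclock⟩⟩
  · rintro m t ⟨hm, htime, ⟨hS', -⟩ | ⟨l, hl, hk, hS', hprog, hclock⟩⟩ hc
    · simp [hS'.config.regD] at hc
    · have hlen := length_le_stackBound hS'.config.store.linked hS'.config.store.nodup_keys
        hB.deg hk
      rw [run_seq]
      refine Run.mono (run_emit_stack hR hS'.tick.config hS'.buf) ?_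
      rintro u ⟨hum, hur, hub, huo, huc⟩
      rw [clock_tick] at huc
      rw [out_tick] at huo
      rw [sol_eq_singleton hadj hS'.config.store.linked hl hS'.config.store.nodup hk] at hprog
      have hnot : (ins l).toFinset ∉ Rem G k F l := by
        refine Set.disjoint_left.1 (disjoint_sol_rem (G := G) (k := k) (F := F) hl) ?_
        rw [sol_eq_singleton hadj hS'.config.store.linked hl hS'.config.store.nodup hk]
        rfl
      have hprog' := hprog.append hnot (nodup_ins hS'.config.store.nodup_keys) u.clock
      rw [← huo] at hprog'
      have htime' := htime.append (c := u.clock) (w := (ins l).reverse.map Fin.val) (by omega)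
      rw [← huo] at htime'
      have hlast : lastTime u.out = u.clock := by rw [huo, lastTime_append]
      have hne : u.out ≠ [] := by rw [huo]; simp
      have hlength : u.out.length = t.out.length + 1 := by rw [huo]; simp
      have hmlt := hprog'.length_le
      rw [run_seq, run_assign]
      refine ⟨by rw [val_lit]; omega, ?_⟩
      refine Run.mono (run_next hadj hR hB (l := l) (F := F) (τ := u.clock) ?_ hl hlen ?_ ?_) ?_
      · refine hS'.tick.congr hum (fun r hr => ?_) hub
        rw [reg_tick, reg_setReg, Function.update_of_ne (by omega)]
        exact hur r (by omega)
      · simp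
      · simp
      · rintro v ⟨hvc, hvo, hv⟩
        rw [out_tick, out_setReg] at hvo
        refine ⟨m - 1, by omega, by rw [hvo]; omega, by rw [hvo]; exact htime', ?_⟩
        rw [hvo, hlast]
        rcases hv with ⟨hv1, hv2⟩ | ⟨hkn, l', hl', hv1, hv2, hv3⟩
        · refine Or.inl ⟨hv1, hne, ?_, by omega⟩
          rw [← hv2]
          exact hprog'
        · refine Or.inr ⟨l', hl', hv2, hv1, ?_, ?_⟩
          · rw [← hv3]
            exact hprog'
          · have := hB.delay hkn
            rw [deadline, if_neg hne, hlast]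
            omega
  · rintro m t ⟨hm, htime, ⟨hS', hne, hprog, hclock⟩ | ⟨l, hl, hk, hS', -⟩⟩ hc
    · exact ⟨hS'.tick, htime, hne, hprog, by rw [clock_tick, out_tick]; omega⟩
    · rw [holds_lt, val_lit, val_reg, hS'.config.regD] at hc
      exact absurd (List.length_pos_iff.2 hl) hc

/-- The treatment of one root. The first root is reached at time `T₀` at the latest; there is
another one only if `k < n`. -/
lemma run_root (hadj : IsAdjacencyList G adj) (hk0 : 0 < k) (hR : Room adj S W (b + n))
    (hb : inputSize adj + n ≤ b) (hB : Bounds adj k D T B₀ B) {T₀ : ℕ}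
    (hT₀ : T₀ + 20 * ∑ v, (1 + (adj v).length) + 8 * stackBound n k D + 20 ≤ B₀) {r : Fin n}
    (hS : Search adj k s b [] (r :: F)) (hfr : Fruitful G k (r :: F))
    (hout : Timely B₀ B s.out) (hprog : Progress G k s.out (Rem G k (r :: F) []))
    (hfirst : s.out = [] → s.clock ≤ T₀)
    (hnext : s.out ≠ [] → k < n ∧ s.clock ≤ lastTime s.out + stackBound n k D * (T + 1) + 4) :
    Run S W rootProg s fun t => Search adj k t b [] F ∧ Timely B₀ B t.out ∧ t.out ≠ [] ∧
        Progress G k t.out (Rem G k F []) ∧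
        t.clock ≤ lastTime t.out + stackBound n k D * (T + 1) + 3 := by
  have h2 := hR.le
  have h3 := hR.lt
  have hR' : Room adj S W b := ⟨hb, by omega, by omega⟩
  have hC := hS.config
  have hr := r.2
  have h4 := hC.store.length_le
  have h5 := hS.roots.1
  rw [List.length_nil, List.length_cons] at h4
  simp only [rootProg, run_seq, run_load, run_assign, run_add, run_sub, run_store, val_reg,
    val_lit, reg_tick, reg_setReg, mem_tick, mem_setReg, reg_setMem, ne_eq, Function.update_self,
    not_false_eq_true, Function.update_of_ne, Nat.reduceEqDiff, hC.regL, hC.regStat, hS.regRoots,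
    hS.regT, List.length_cons, Nat.add_sub_cancel, h5]
  refine ⟨by omega, by omega, by omega, by omega, by omega, by omega, by omega, by omega, by omega,
    by omega, by omega, ?_⟩
  have hSt := hC.store.pushRoot hb
  refine Run.mono (run_extend hR' (l := [(r, true)]) (F := F) ⟨hSt, ?_, ?_, ?_, ?_⟩ ?_) ?_
  · simp [hC.regL]
  · simp [hC.regStat]
  · simp
  · simp
  · simp [hS.regLim]
    omega
  rintro t ⟨E, hCt, hlim, hclosed, hF, hclock⟩
  have hreg : ∀ x, x < rD ∨ x = rT → x ≠ rT → t.reg x = s.reg x := by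
    intro x hx hx'
    rw [hF.reg x (by omega)]
    simp only [reg_tick, reg_setReg, reg_setMem]
    iterate 6 rw [Function.update_of_ne (by omega)]
  have hTt : t.reg rT = F.length := (hF.reg _ (by norm_num)).trans (by simp)
  have hLs : s.reg rLim = k := hS.regLim
  simp only [reg_tick, reg_setReg, reg_setMem, ne_eq, not_false_eq_true, Function.update_of_ne,
    Nat.reduceEqDiff, hLs, clock_tick, clock_setReg, clock_setMem] at hlim hclosed hclock
  have hto : t.out = s.out := hF.out
  have hins : (ins (push E [(r, true)])).length = k := by
    refine le_antisymm hlim (not_lt.1 fun hlt => ?_)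
    exact absurd (hfr.not_closed hadj hCt.store.nodup_keys (hclosed hlt)) (by omega)
  have hSearch : Search adj k t b (push E [(r, true)]) F := by
    refine ⟨hCt, hins.le, (hreg _ (by norm_num) (by norm_num)).trans hS.regN,
      (hreg _ (by norm_num) (by norm_num)).trans hS.regK,
      (hreg _ (by norm_num) (by norm_num)).trans hS.regLim,
      (hreg _ (by norm_num) (by norm_num)).trans hS.regRoots, hTt,
      hS.roots.2.congr fun i hi => ?_, hF.buf.trans hS.buf⟩
    rw [hF.mem _ (by omega) (by omega)]
    simp only [mem_tick, mem_setReg, mem_setMem]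
    iterate 2 rw [Function.update_of_ne (by omega)]
  have hlen := length_le_stackBound hCt.store.linked hCt.store.nodup_keys hB.deg hins
  refine run_solutions hadj hR' hB hSearch (by simp [push]) hins (hto ▸ hout) ?_ ?_
  · rw [sol_union_rem_push E (by simp), sol_union_rem_root, hto]
    exact hprog
  · rw [hto, deadline]
    split_ifs with h0
    · have := hfirst h0
      have := work_le_sum (adj := adj) hCt.store.nodup_keys
      omega
    · obtain ⟨hkn, hc⟩ := hnext h0
      have h6 := hB.delay hkn
      have h7 := hB.try_le hkn
      have h8 := work_le hB.deg (push E [(r, true)])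
      rw [hins] at h8
      omega

/-- The enumeration phase. For `k = n` a fruitful root has no successor, so that the delay bound is
needed only for `k < n`. -/
lemma run_roots (hadj : IsAdjacencyList G adj) (hk0 : 0 < k) (hR : Room adj S W (b + n))
    (hb : inputSize adj + n ≤ b) (hB : Bounds adj k D T B₀ B) {T₀ : ℕ}
    (hT₀ : T₀ + 20 * ∑ v, (1 + (adj v).length) + 8 * stackBound n k D + 21 ≤ B₀)
    (hS : Search adj k s b [] F) (hfr : Fruitful G k F) (hout : s.out = [])
    (hprog : Progress G k [] (Rem G k F [])) (hfirst : s.clock ≤ T₀) :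
    Run S W (.loop (.lt §0 ®rT) rootProg) s fun t => Timely B₀ B t.out ∧
        Progress G k t.out ∅ ∧
        (t.out = [] → t.clock ≤ T₀ + 1) ∧
        (t.out ≠ [] → t.clock ≤ lastTime t.out + stackBound n k D * (T + 1) + 4) := by
  refine run_loop (fun m t => ∃ F, F.length = m ∧ Search adj k t b [] F ∧ Fruitful G k F ∧
    Timely B₀ B t.out ∧ Progress G k t.out (Rem G k F []) ∧ (t.out = [] → t.clock ≤ T₀) ∧
    (t.out ≠ [] → (F ≠ [] → k < n) ∧
      t.clock ≤ lastTime t.out + stackBound n k D * (T + 1) + 3)) (m := F.length) ?_ ?_ ?_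
  · refine ⟨F, rfl, hS, hfr, ?_, by rwa [hout], fun _ => hfirst, fun h => absurd hout h⟩
    rw [hout]
    exact ⟨List.isChain_nil, by simp⟩
  · rintro m t ⟨F, hm, hS, hfr, htime, hprog, h1, h2⟩ hc
    simp only [holds_lt, val_lit, val_reg, hS.regT] at hc
    obtain ⟨r, F, rfl⟩ := List.exists_cons_of_ne_nil (List.length_pos_iff.1 hc)
    refine Run.mono (run_root hadj hk0 hR hb hB (T₀ := T₀ + 1) (by omega) hS.tick hfr htime hprog
      ?_ ?_) ?_
    · intro h
      rw [clock_tick]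
      have := h1 h
      omega
    · intro h
      rw [clock_tick]
      obtain ⟨h3, h4⟩ := h2 h
      exact ⟨h3 (by simp), by rw [out_tick]; omega⟩
    · rintro u ⟨hSu, htu, hne, hpu, hcu⟩
      refine ⟨F.length, by simp at hm; omega, F, rfl, hSu, hfr.2, htu, hpu,
        fun h => absurd h hne, fun _ => ⟨fun hF => ?_, hcu⟩⟩
      refine lt_of_le_of_ne hfr.le ?_
      rintro rfl
      exact hF hfr.eq_nil
  · rintro m t ⟨F, hm, hS, hfr, htime, hprog, h1, h2⟩ hc
    simp only [holds_lt, val_lit, val_reg, hS.regT, not_lt] at hc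
    obtain rfl : F = [] := List.eq_nil_of_length_eq_zero (by omega)
    refine ⟨htime, ?_, fun h => ?_, fun h => ?_⟩
    · have : Rem G k [] [] = ∅ := by
        rw [Set.eq_empty_iff_forall_notMem]
        rintro X ⟨-, v, hv, -⟩
        simp at hv
      rwa [this] at hprog
    · have := h1 h
      rw [clock_tick]
      omega
    · have := (h2 h).2
      rw [clock_tick, out_tick]
      omega

end

section

variable {n : ℕ} {adj : Fin n → List (Fin n)} {k : ℕ} {G : SimpleGraph (Fin n)}
  {S W : ℕ} {s t : State} {l : List (Fin n × Bool)} {V R : List (Fin n)}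

/-! ### The initial memory -/

lemma length_encode (k : ℕ) (adj : Fin n → List (Fin n)) :
    (encode k adj).length = inputSize adj := by
  simp [encode, inputSize, List.length_flatMap]
  omega

lemma encode_getD_address (k : ℕ) (adj : Fin n → List (Fin n)) {i : ℕ} (hi : i ≤ n) :
    (encode k adj).getD (i + 2) 0 =
      n + 3 + (((List.finRange n).take i).map fun v => (adj v).length).sum := by
  rw [encode, List.append_assoc, List.getD_append_right _ _ _ _ (by simp)]
  rw [List.getD_append _ _ _ _ (by simp; omega)]
  simp [List.getD_eq_getElem?_getD, hi]

lemma graphAt_encode (k : ℕ) (adj : Fin n → List (Fin n)) :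
    GraphAt adj fun i => (encode k adj).getD i 0 where
  lo v := encode_getD_address k adj v.2.le
  hi v := by
    have h : (List.finRange n).take (v + 1) = (List.finRange n).take v ++ [v] := by
      rw [List.take_add_one]
      simp
    have := encode_getD_address k adj (i := v + 1) v.2
    rw [h, List.map_append, List.sum_append, List.map_singleton, List.sum_singleton] at this
    rw [offset, add_assoc (n + 3), ← this]
  nbr v j hj := by
    have h : List.finRange n = (List.finRange n).take v ++ v :: (List.finRange n).drop (v + 1) := by
      conv_lhs => rw [← List.take_append_drop v (List.finRange n)]
      rw [List.drop_eq_getElem_cons (by simp)]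
      simp
    have hlen : (((List.finRange n).take v).flatMap fun v => (adj v).map Fin.val).length =
        (((List.finRange n).take v).map fun v => (adj v).length).sum := by
      simp [List.length_flatMap]
    have hflat : ((List.finRange n).flatMap fun v => (adj v).map Fin.val) =
        (((List.finRange n).take v).flatMap fun v => (adj v).map Fin.val) ++
          ((adj v).map Fin.val ++
            ((List.finRange n).drop (v + 1)).flatMap fun v => (adj v).map Fin.val) := by
      conv_lhs => rw [h]
      rw [List.flatMap_append, List.flatMap_cons]
    rw [encode, List.getD_append_right _ _ _ _ (by simp [offset]; omega), hflat,
      List.getD_append_right _ _ _ _ (by rw [hlen]; simp [offset]; omega),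
      List.getD_append _ _ _ _ (by rw [hlen]; simp [offset]; omega), hlen]
    have : offset adj v + j - ([n, k] ++ (List.range (n + 1)).map fun i => n + 3 +
        (((List.finRange n).take i).map fun v => (adj v).length).sum).length -
        (((List.finRange n).take v).map fun v => (adj v).length).sum = j := by
      simp [offset]
      omega
    rw [this]
    simp [hj]

/-! ### The computation of the roots -/

/-- The state of the preparatory phase: the search stack is `l`, the vertices in `V` have been
visited, and `R` is the stack of the roots found. -/
structure Prep (G : SimpleGraph (Fin n)) (adj : Fin n → List (Fin n)) (k : ℕ) (s : State)
    (l : List (Fin n × Bool)) (V R : List (Fin n)) : Prop where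
  config : Config adj s (inputSize adj + n) l V
  regN : s.reg rN = n
  regK : s.reg rK = k
  regLim : s.reg rLim = n + 1
  regStat2 : s.reg rStat2 = inputSize adj + n + n
  regRoots : s.reg rRoots = inputSize adj + n + n + n
  regT : s.reg rT = R.length
  stat2 : ∀ v : Fin n, s.mem (inputSize adj + n + n + v) = status [] R v
  roots : StackAt s.mem (inputSize adj + n + n + n) R
  buf : s.buf = []
  out : s.out = []
  nodup : R.Nodup
  subset : R ⊆ V
  fruitful : Fruitful G k R

lemma Prep.of_frame {l' : List (Fin n × Bool)} {V' : List (Fin n)} (h : Prep G adj k s l V R)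
    (hF : Frame adj (inputSize adj + n) rRun s t)
    (hC : Config adj t (inputSize adj + n) l' V') (hV : V ⊆ V') : Prep G adj k t l' V' R where
  config := hC
  regN := (hF.reg _ (by norm_num)).trans h.regN
  regK := (hF.reg _ (by norm_num)).trans h.regK
  regLim := (hF.reg _ (by norm_num)).trans h.regLim
  regStat2 := (hF.reg _ (by norm_num)).trans h.regStat2
  regRoots := (hF.reg _ (by norm_num)).trans h.regRoots
  regT := (hF.reg _ (by norm_num)).trans h.regT
  stat2 v := (hF.mem _ (by omega) (by omega)).trans (h.stat2 v)
  roots := h.roots.congr fun i _ => hF.mem _ (by omega) (by omega)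
  buf := hF.buf.trans h.buf
  out := hF.out.trans h.out
  nodup := h.nodup
  subset := List.Subset.trans h.subset hV
  fruitful := h.fruitful

lemma Prep.congr (h : Prep G adj k s l V R) (hm : t.mem = s.mem)
    (hr : ∀ r, r ≤ rCount ∨ r = rT ∨ r = rStat2 → t.reg r = s.reg r) (hb : t.buf = s.buf)
    (ho : t.out = s.out) : Prep G adj k t l V R where
  config := ⟨by rw [hm]; exact h.config.store, (hr _ (by norm_num)).trans h.config.regL,
    (hr _ (by norm_num)).trans h.config.regStat, (hr _ (by norm_num)).trans h.config.regD,
    (hr _ (by norm_num)).trans h.config.regCount⟩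
  regN := (hr _ (by norm_num)).trans h.regN
  regK := (hr _ (by norm_num)).trans h.regK
  regLim := (hr _ (by norm_num)).trans h.regLim
  regStat2 := (hr _ (by norm_num)).trans h.regStat2
  regRoots := (hr _ (by norm_num)).trans h.regRoots
  regT := (hr _ (by norm_num)).trans h.regT
  stat2 := by rw [hm]; exact h.stat2
  roots := by rw [hm]; exact h.roots
  buf := hb.trans h.buf
  out := ho.trans h.out
  nodup := h.nodup
  subset := h.subset
  fruitful := h.fruitful

lemma Prep.tick (h : Prep G adj k s l V R) : Prep G adj k s.tick l V R :=
  h.congr rfl (fun _ _ => rfl) rfl rfl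

lemma Prep.addRoot {u : Fin n} (h : Prep G adj k s l V R) (hu : u ∉ R) (huV : u ∈ V)
    (hf : Fruitful G k (u :: R))
    (hreg : ∀ r, r ≠ rX → r ≠ rT → t.reg r = s.reg r) (hT : t.reg rT = R.length + 1)
    (hmem : t.mem = Function.update (Function.update s.mem (inputSize adj + n + n + u) 2)
      (inputSize adj + n + n + n + R.length) u) (hbuf : t.buf = s.buf) (hout : t.out = s.out) :
    Prep G adj k t l V (u :: R) := by
  have hn := u.2
  refine ⟨⟨h.config.store.congr ?_ ?_, ?_, ?_, ?_, ?_⟩, ?_, ?_, ?_, ?_, ?_, ?_, ?_, ?_,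
    hbuf.trans h.buf, hout.trans h.out, List.nodup_cons.2 ⟨hu, h.nodup⟩,
    List.cons_subset.2 ⟨huV, h.subset⟩, hf⟩
  · intro a ha
    rw [hmem, Function.update_of_ne (by omega), Function.update_of_ne (by omega)]
  · intro v
    rw [hmem, Function.update_of_ne (by omega), Function.update_of_ne (by omega)]
  · rw [hreg _ (by norm_num) (by norm_num), h.config.regL]
  · rw [hreg _ (by norm_num) (by norm_num), h.config.regStat]
  · rw [hreg _ (by norm_num) (by norm_num), h.config.regD]
  · rw [hreg _ (by norm_num) (by norm_num), h.config.regCount]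
  · rw [hreg _ (by norm_num) (by norm_num), h.regN]
  · rw [hreg _ (by norm_num) (by norm_num), h.regK]
  · rw [hreg _ (by norm_num) (by norm_num), h.regLim]
  · rw [hreg _ (by norm_num) (by norm_num), h.regStat2]
  · rw [hreg _ (by norm_num) (by norm_num), h.regRoots]
  · rw [hT, List.length_cons]
  · intro v
    rw [hmem, Function.update_of_ne (by omega)]
    by_cases hv : v = u
    · subst hv
      simp [status]
    · have : (v : ℕ) ≠ u := fun h => hv (Fin.ext h)
      rw [Function.update_of_ne (by omega), h.stat2 v]
      exact status_congr (by simp) (by simp [hv])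
  · rw [hmem]
    refine ⟨by simp, h.roots.congr fun i hi => ?_⟩
    rw [Function.update_of_ne (by omega), Function.update_of_ne (by omega)]

/-- The root pass over a component: a vertex above at least `k - 1` others on the stack becomes a
root, because the vertices below it, together with itself, form a connected set that avoids the
roots found before. -/
lemma run_collect (hadj : IsAdjacencyList G adj)
    (hR : Room adj S W (inputSize adj + n + n + n)) {C : List (Fin n)}
    (hS : Prep G adj k s (push C []) V R) :
    Run S W collectProg s fun t => ∃ V' R', Prep G adj k t [] V' R' ∧ V'.Perm (C ++ V) ∧ R ⊆ R' ∧
      (∀ X : Finset (Fin n), X ⊆ C.toFinset → 0 < k → k ≤ X.card → ∃ r ∈ R', r ∈ X) ∧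
      t.reg rU = s.reg rU ∧ t.clock ≤ s.clock + 1 + 14 * C.length := by
  have h2 := hR.le
  have h3 := hR.lt
  have hR' : Room adj S W (inputSize adj + n) := ⟨le_rfl, by omega, by omega⟩
  refine run_loop (fun m t => ∃ C' V' R', C'.length = m ∧ Prep G adj k t (push C' []) V' R' ∧
    (C' ++ V').Perm (C ++ V) ∧ R ⊆ R' ∧
    (∀ X : Finset (Fin n), X ⊆ C.toFinset → k ≤ X.card →
      (∃ r ∈ R', r ∈ X) ∨ X ⊆ C'.toFinset) ∧
    t.reg rU = s.reg rU ∧ t.clock + 14 * C'.length ≤ s.clock + 14 * C.length)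
    (m := C.length) ?_ ?_ ?_
  · exact ⟨C, V, R, rfl, hS, List.Perm.refl _, List.Subset.refl _, fun X hX _ => Or.inr hX, rfl,
      le_rfl⟩
  · rintro m t ⟨C', V', R', hm, hS, hperm, hsub, hcov, hU, hclock⟩ hc
    have hC := hS.config
    simp only [holds_lt, val_lit, val_reg, hC.regD, length_push, List.length_nil,
      Nat.add_zero] at hc
    obtain ⟨u, C', rfl⟩ := List.exists_cons_of_ne_nil (List.length_pos_iff.1 hc)
    have hu := u.2
    have hle := hC.store.length_le
    simp only [length_push, List.length_nil, List.length_cons, Nat.add_zero] at hle hm hclock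
    have hforb := hC.store.forbidTop le_rfl
    have hnd := hC.store.nodup
    have hnot : u ∉ R' := fun h => by
      simp only [push_cons, keys_cons, List.cons_append, List.nodup_cons, List.mem_append,
        not_or] at hnd
      exact hnd.1.2 (hS.subset h)
    have hRn : R'.length < n := by
      have := (List.nodup_cons.2 ⟨hnot, hS.nodup⟩).length_le_card
      simp at this
      omega
    rw [run_seq, run_assign]
    refine ⟨by simp only [val_reg, reg_tick, hC.regD, length_push, List.length_cons,
      List.length_nil]; omega, ?_⟩
    rw [run_seq]
    refine run_pop (p := (u, true)) (l := push C' []) (F := V') hR' hC.store ?_ ?_ ?_ ?_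
    · simp [hC.regL]
    · simp [hC.regStat]
    · simp [hC.regD]
    have hF0 : Frame adj (inputSize adj + n) rRun t (((((t.tick.setReg rY
        (t.reg rD)).tick.setReg rD C'.length).tick.setReg rX (inputSize adj + C'.length)).tick.setReg
        rV u).tick.setReg rX (inputSize adj + n + u)).tick := by
      repeat first
        | exact Frame.rfl
        | apply Frame.tick
        | refine Frame.setReg ?_ (by norm_num)
    simp only [run_seq, run_cond, run_skip, run_add, run_sub, run_store, val_reg, val_lit,
      reg_tick, reg_setReg, reg_setMem, holds_lt, ne_eq, Function.update_self,
      not_false_eq_true, Function.update_of_ne, Nat.reduceEqDiff, hC.regD, hS.regK, length_push,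
      List.length_nil, List.length_cons, Nat.add_zero, hS.regStat2, hS.regRoots, hS.regT,
      hC.regCount, ins_push, ins_nil, List.append_nil, Nat.add_sub_cancel] at hF0 ⊢
    have hP := hS.of_frame (((hF0.setStat u (x := 2)).tick.setReg (r := rCount) (x := C'.length)
      (by norm_num)).tick.tick) (l' := push C' []) (V' := u :: V')
      ⟨hforb, by simp [hC.regL], by simp [hC.regStat], by simp, by simp⟩
      (List.subset_cons_self _ _)
    refine ⟨by omega, by omega, by omega, fun hk => ?_, fun hk => ?_⟩
    · replace hP := hP.tick
      refine ⟨C'.length, by omega, C', u :: V', R', rfl, hP,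
        List.perm_middle.trans hperm, hsub, ?_, by simpa using hU, by simp; omega⟩
      intro X hX hkX
      rcases hcov X hX hkX with h | h
      · exact Or.inl h
      · have h4 := Finset.card_le_card h
        have h5 := List.toFinset_card_le (u :: C')
        rw [List.length_cons] at h5
        omega
    · refine ⟨by omega, by omega, by omega, by omega, by omega, by omega, by omega, ?_⟩
      have hlinked := hC.store.linked
      refine ⟨C'.length, by omega, C', u :: V', u :: R', rfl, hP.addRoot hnot (by simp)
        ⟨⟨_, hlinked.connected hadj (by simp), by simp, ?_, ?_⟩, hS.fruitful⟩ ?_ ?_ ?_ ?_ ?_,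
        List.perm_middle.trans hperm, List.subset_cons_of_subset _ hsub, ?_, by simpa using hU,
        by simp; omega⟩
      · rw [List.toFinset_card_of_nodup (nodup_ins hC.store.nodup_keys)]
        simp
        omega
      · intro v hv hv'
        rw [List.mem_toFinset] at hv'
        exact (List.nodup_append.1 hnd).2.2 v (mem_keys.2 (Or.inl hv')) v (hS.subset hv) rfl
      · intro r hrX hrT
        simp [Function.update_of_ne hrX, Function.update_of_ne hrT]
      · simp
      · simp
      · simp
      · simp
      · intro X hX hkX
        by_cases hu : u ∈ X
        · exact Or.inl ⟨u, by simp, hu⟩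
        · rcases hcov X hX hkX with ⟨r, hr, hrX⟩ | h
          · exact Or.inl ⟨r, by simp [hr], hrX⟩
          · refine Or.inr fun x hx => ?_
            have := h hx
            rw [List.mem_toFinset, List.mem_cons] at this
            rw [List.mem_toFinset]
            rcases this with rfl | h
            · exact absurd hx hu
            · exact h
  · rintro m t ⟨C', V', R', hm, hS, hperm, hsub, hcov, hU, hclock⟩ hc
    simp only [holds_lt, val_lit, val_reg, hS.config.regD, length_push, List.length_nil,
      Nat.add_zero, not_lt] at hc
    obtain rfl : C' = [] := List.eq_nil_of_length_eq_zero (by omega)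
    refine ⟨V', R', hS.tick, hperm, hsub, ?_, hU, ?_⟩
    · intro X hX hk0 hkX
      rcases hcov X hX hkX with h | h
      · exact h
      · rw [List.toFinset_nil, Finset.subset_empty] at h
        simp [h] at hkX
        omega
    · rw [clock_tick]
      simp at hclock
      omega

end

section

variable {n : ℕ} {adj : Fin n → List (Fin n)} {k : ℕ} {G : SimpleGraph (Fin n)}
  {S W : ℕ} {s t : State} {l : List (Fin n × Bool)} {V R : List (Fin n)}

/-- The time spent on the visited vertices: at most `20 * (1 + deg v)` for the scan of `v` and
`14` for its removal from the stack. -/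
def visitTime (adj : Fin n → List (Fin n)) (V : List (Fin n)) : ℕ :=
  (V.map fun v => 34 * (1 + (adj v).length)).sum

lemma visitTime_le (h : V.Nodup) : visitTime adj V ≤ 34 * ∑ v : Fin n, (1 + (adj v).length) := by
  rw [visitTime, ← List.sum_toFinset _ h, Finset.mul_sum]
  exact Finset.sum_le_sum_of_subset (Finset.subset_univ _)

lemma work_push_le (C : List (Fin n)) : work adj (push C []) + 14 * C.length ≤ visitTime adj C := by
  simp only [work, visitTime, length_push, ins_push, ins_nil, List.append_nil, List.length_nil]
  induction C with
  | nil => simp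
  | cons v C ih =>
    simp only [List.length_cons, List.map_cons, List.sum_cons]
    omega

/-- Between two explorations the visited vertices form a union of components, all of whose
connected `k`-sets contain a root. -/
structure Explored (G : SimpleGraph (Fin n)) (adj : Fin n → List (Fin n)) (k : ℕ)
    (V R : List (Fin n)) : Prop where
  closed : ∀ v ∈ V, ∀ w ∈ adj v, w ∈ V
  cover : ∀ X ∈ connectedSets G k, (∃ v ∈ X, v ∈ V) → ∃ r ∈ R, r ∈ X

/-- A vertex that has not been visited lies in a component without visited vertices. The limit
`n + 1` is never reached, so that the extension ends with the whole component on the stack. -/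
lemma run_component (hadj : IsAdjacencyList G adj) (hk : 0 < k)
    (hR : Room adj S W (inputSize adj + n + n + n)) (hS : Prep G adj k s [] V R)
    (hE : Explored G adj k V R) {u : Fin n} (hu : s.reg rU = u) :
    Run S W componentProg s fun t => ∃ V' R', Prep G adj k t [] V' R' ∧ Explored G adj k V' R' ∧
      V ⊆ V' ∧ u ∈ V' ∧ t.reg rU = u + 1 ∧
      t.clock + visitTime adj V ≤ s.clock + visitTime adj V' + 11 := by
  have h2 := hR.le
  have h3 := hR.lt
  have hR' : Room adj S W (inputSize adj + n) := ⟨le_rfl, by omega, by omega⟩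
  have hC := hS.config
  have hst := hC.store.stat u
  have hst' := status_le [] V u
  have hun := u.2
  have hF0 : Frame adj (inputSize adj + n) rRun s ((s.setReg rX
      (inputSize adj + n + u)).tick.setReg rY (status [] V u)).tick := by
    repeat first
      | exact Frame.rfl
      | apply Frame.tick
      | refine Frame.setReg ?_ (by norm_num)
  simp only [componentProg, run_seq, run_cond, run_skip, run_add, run_assign, run_load, run_store,
    val_reg, val_lit, reg_tick, reg_setReg, reg_setMem, mem_tick, mem_setReg, holds_eq, ne_eq,
    Function.update_self, not_false_eq_true, Function.update_of_ne, Nat.reduceEqDiff, hC.regL,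
    hC.regStat, hu, hst]
  refine ⟨by omega, by omega, by omega, fun h0 => ?_, fun h0 => ?_⟩
  · rw [status_eq_zero] at h0
    have hP := hC.store.pushTop (w := u) le_rfl h0.1 h0.2 (Or.inl rfl)
    refine ⟨by omega, by omega, by omega, by omega, by omega, by omega, ?_⟩
    refine Run.mono (run_extend hR' (l := [(u, true)]) (F := V) ⟨hP, ?_, ?_, ?_, ?_⟩ ?_) ?_
    · simp [hC.regL]
    · simp [hC.regStat]
    · simp
    · simp
    · simp [hS.regLim]
    rintro t ⟨E, hCt, -, hclosed, hF, hclock⟩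
    simp only [clock_tick, clock_setReg, clock_setMem] at hclock
    have hpush : push E [(u, true)] = push (E ++ [u]) [] := by simp [push]
    have hUt : t.reg rU = u := (hF.reg _ (by norm_num)).trans (by simp [hu])
    have hcl : Closed adj (push E [(u, true)]) V := by
      refine hclosed ?_
      have h4 := hCt.store.length_le
      have h5 := length_ins_le (push E [(u, true)])
      simp only [reg_tick, reg_setReg, reg_setMem, ne_eq, not_false_eq_true,
        Function.update_of_ne, Nat.reduceEqDiff, hS.regLim]
      omega
    have hPt : Prep G adj k t (push (E ++ [u]) []) V R := by
      rw [← hpush]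
      refine hS.of_frame (Frame.trans ?_ (hF.mono (by norm_num))) hCt (List.Subset.refl _)
      refine Frame.tick (Frame.setReg (Frame.tick (Frame.setReg (Frame.tick (Frame.setStack (i := 0)
        (Frame.tick (Frame.setStat (Frame.tick hF0) u)) (by omega))) (by norm_num))) (by norm_num))
    rw [hpush] at hcl hclock
    have hwork := work_push_le (adj := adj) (E ++ [u])
    refine Run.mono (run_collect hadj hR hPt) ?_
    rintro t' ⟨V', R', hP', hperm, hsub, hcov, hU', hclock'⟩
    have hmem : ∀ v, v ∈ V' ↔ v ∈ E ++ [u] ∨ v ∈ V := fun v => by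
      rw [hperm.mem_iff, List.mem_append]
    have htime : visitTime adj V' = visitTime adj (E ++ [u]) + visitTime adj V := by
      rw [visitTime, (hperm.map _).sum_eq, List.map_append, List.sum_append]
      rfl
    have hclosed' : ∀ v ∈ E ++ [u], ∀ w ∈ adj v, w ∈ E ++ [u] ∨ w ∈ V := by
      simpa [Closed] using hcl
    refine ⟨by omega, V', R', hP'.congr rfl (fun r hr => Function.update_of_ne (by omega) _ _)
      rfl rfl, ⟨?_, ?_⟩, fun v hv => (hmem v).2 (Or.inr hv), (hmem u).2 (Or.inl (by simp)), ?_, ?_⟩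
    · intro v hv w hw
      rw [hmem] at hv ⊢
      rcases hv with hv | hv
      · exact hclosed' v hv w hw
      · exact Or.inr (hE.closed v hv w hw)
    · rintro X hX ⟨v, hvX, hv⟩
      by_cases hXV : ∃ v ∈ X, v ∈ V
      · obtain ⟨r, hr, hrX⟩ := hE.cover X hX hXV
        exact ⟨r, hsub hr, hrX⟩
      · have hvC : v ∈ E ++ [u] := ((hmem v).1 hv).resolve_right fun h => hXV ⟨v, hvX, h⟩
        refine hcov X ?_ hk hX.1.ge
        have hsubset := subset_of_connected (I := {x | x ∈ E ++ [u]}) hX.2 (r := v) hvX hvC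
          fun x _ hx y hy hxy => (hclosed' x hx y (((hadj x).2 y).2 hxy)).resolve_right
            fun h => hXV ⟨y, hy, h⟩
        exact fun x hx => List.mem_toFinset.2 (hsubset hx)
    · simp [hU', hUt]
    · simp only [clock_tick, clock_setReg]
      omega
  · have huV : u ∈ V := by
      by_contra h
      exact h0 (status_eq_zero.2 ⟨by simp, h⟩)
    refine ⟨by omega, V, R, hS.congr rfl (fun r hr => ?_) rfl rfl, hE, List.Subset.refl _, huV,
      by simp, by simp; omega⟩
    simp only [reg_tick, reg_setReg]
    iterate 3 rw [Function.update_of_ne (by omega)]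

/-- A time bound for the preparatory phase. -/
def prepTime (adj : Fin n → List (Fin n)) : ℕ :=
  12 * n + 34 * ∑ v, (1 + (adj v).length) + 11

/-- The whole program: all connected `k`-sets are written, in time. -/
lemma run_main (hadj : IsAdjacencyList G adj) (hk : 0 < k)
    (hR : Room adj S W (inputSize adj + n + n + n)) (hW : k < W) {D T B₀ B : ℕ}
    (hB : Bounds adj k D T B₀ B)
    (hB₀ : prepTime adj + 20 * ∑ v, (1 + (adj v).length) + 8 * stackBound n k D + 21 ≤ B₀) :
    Run S W mainProg (initState (encode k adj)) fun t => Timely B₀ B t.out ∧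
      Progress G k t.out ∅ ∧
      (t.out = [] → t.clock ≤ prepTime adj + 1) ∧
      (t.out ≠ [] → t.clock ≤ lastTime t.out + stackBound n k D * (T + 1) + 4) := by
  have h2 := hR.le
  have h3 := hR.lt
  have hL := le_inputSize (adj := adj)
  have hg := graphAt_encode k adj
  have hend : (initState (encode k adj)).mem (n + 2) = inputSize adj := by
    refine (encode_getD_address k adj le_rfl).trans ?_
    rw [List.take_of_length_le (by simp), inputSize]
  have hm0 : (initState (encode k adj)).mem 0 = n := by simp [initState, encode]
  have hm1 : (initState (encode k adj)).mem 1 = k := by simp [initState, encode]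
  have hzero : ∀ a, inputSize adj ≤ a → (initState (encode k adj)).mem a = 0 := by
    intro a ha
    exact List.getD_eq_default _ _ (by rwa [length_encode])
  have hreg0 : ∀ r, (initState (encode k adj)).reg r = 0 := fun _ => rfl
  have hclk0 : (initState (encode k adj)).clock = 0 := rfl
  have hout0 : (initState (encode k adj)).out = [] := rfl
  have hbuf0 : (initState (encode k adj)).buf = [] := rfl
  have hg' : GraphAt adj (initState (encode k adj)).mem := hg
  generalize initState (encode k adj) = s at *
  simp only [mainProg, setupProg, run_seq, run_add, run_load, val_reg, val_lit, reg_tick,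
    reg_setReg, mem_tick, mem_setReg, ne_eq, Function.update_self, not_false_eq_true,
    Function.update_of_ne, OfNat.zero_ne_ofNat, zero_ne_one, hm0, hm1, hend]
  refine ⟨by omega, by omega, by omega, by omega, by omega, by omega, by omega, by omega, by omega,
    by omega, by omega, ?_⟩
  refine run_loop (fun m t => ∃ V R, Prep G adj k t [] V R ∧ Explored G adj k V R ∧
    (∀ v : Fin n, (v : ℕ) < t.reg rU → v ∈ V) ∧ t.reg rU + m = n ∧
    t.clock ≤ 8 + 12 * t.reg rU + visitTime adj V) (m := n) ?_ ?_ ?_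
  · refine ⟨[], [], ⟨⟨⟨hg', trivial, fun v => ?_, by simp, trivial⟩, ?_, ?_, ?_, ?_⟩,
      ?_, ?_, ?_, ?_, ?_, ?_, fun v => ?_, trivial, hbuf0, hout0, by simp, by simp, trivial⟩,
      ⟨by simp, by simp⟩, ?_, ?_, ?_⟩
    all_goals simp [hreg0, hclk0, hzero, add_assoc, visitTime, status]
  · rintro m t ⟨V, R, hP, hE, hV, hm, hclock⟩ hc
    simp only [holds_lt, val_reg, hP.regN] at hc
    refine Run.mono (run_component (u := ⟨t.reg rU, hc⟩) hadj hk hR hP.tick hE rfl) ?_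
    rintro u ⟨V', R', hP', hE', hsub, hu, hU, hclock'⟩
    refine ⟨m - 1, by omega, V', R', hP', hE', ?_, by rw [hU]; simp; omega, ?_⟩
    · intro v hv
      rw [hU] at hv
      rcases Nat.lt_succ_iff_lt_or_eq.1 hv with h | h
      · exact hsub (hV v h)
      · have : v = ⟨t.reg rU, hc⟩ := Fin.ext h
        rwa [this]
    · rw [hU]
      rw [clock_tick] at hclock'
      simp only
      omega
  · rintro m t ⟨V, R, hP, hE, hV, hm, hclock⟩ hc
    simp only [holds_lt, val_reg, hP.regN, not_lt] at hc
    have hV' : ∀ v : Fin n, v ∈ V := fun v => hV v (by omega)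
    have hVt := visitTime_le (adj := adj) (by simpa using hP.config.store.nodup : V.Nodup)
    have hRn := hP.nodup.length_le_card
    simp only [run_assign, val_reg, reg_tick, reg_setReg, ne_eq,
      not_false_eq_true, Function.update_of_ne, OfNat.one_ne_ofNat,
      hP.regStat2, hP.regK]
    refine ⟨by omega, by omega, ?_⟩
    refine run_roots (b := inputSize adj + n + n) (F := R) hadj hk hR (by omega) hB hB₀ ?_
      hP.fruitful ?_ ?_ ?_
    · refine ⟨⟨⟨hP.config.store.graph, trivial, hP.stat2, by simpa using hP.nodup, trivial⟩,
        ?_, ?_, ?_, ?_⟩, by simp, ?_, ?_, ?_, ?_, ?_, hP.roots, hP.buf⟩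
      all_goals simp [hP.config.regL, hP.config.regD, hP.config.regCount, hP.regN, hP.regK,
        hP.regRoots, hP.regT]
    · exact hP.out
    · refine ⟨[], rfl, by simp, by simp, fun X => ?_, by simp⟩
      simp only [List.not_mem_nil, false_or]
      refine ⟨fun hX => ⟨hX, ?_⟩, fun hX => hX.1⟩
      have hX0 : X.Nonempty := by
        rw [← Finset.card_pos, hX.1]
        exact hk
      obtain ⟨v, hv⟩ := hX0
      exact hE.cover X hX ⟨v, hv, hV' v⟩
    · simp only [clock_tick, clock_setReg, prepTime]
      omega

end

section

variable {n : ℕ} {adj : Fin n → List (Fin n)} {k : ℕ} {G : SimpleGraph (Fin n)}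

/-! ### The time bounds -/

lemma length_eq_degree [DecidableRel G.Adj] (hadj : IsAdjacencyList G adj) (v : Fin n) :
    (adj v).length = G.degree v := by
  rw [← G.card_neighborFinset_eq_degree, ← List.toFinset_card_of_nodup (hadj v).1]
  congr 1
  ext w
  simp [(hadj v).2 w]

lemma sum_length [DecidableRel G.Adj] (hadj : IsAdjacencyList G adj) :
    ∑ v, (1 + (adj v).length) = n + 2 * G.edgeFinset.card := by
  rw [← G.sum_degrees_eq_twice_card_edges, Finset.sum_add_distrib]
  simp [length_eq_degree hadj]

lemma inputSize_eq [DecidableRel G.Adj] (hadj : IsAdjacencyList G adj) :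
    inputSize adj = n + 3 + 2 * G.edgeFinset.card := by
  rw [← G.sum_degrees_eq_twice_card_edges, inputSize]
  congr 1
  rw [← List.sum_toFinset _ (List.nodup_finRange n)]
  simp [length_eq_degree hadj]

/-- A connected set with two vertices needs an edge. -/
lemma maxDegree_pos [DecidableRel G.Adj] {X : Finset (Fin n)} (hX : X ∈ connectedSets G k)
    (hk : 2 ≤ k) : 0 < G.maxDegree := by
  by_contra h0
  have hX0 : X.Nonempty := by
    rw [← Finset.card_pos, hX.1]
    omega
  obtain ⟨r, hr⟩ := hX0
  have := subset_of_connected (I := {r}) hX.2 (r := r) hr rfl (by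
    intro v _ _ w _ hvw
    have h1 := (G.degree_pos_iff_exists_adj v).2 ⟨w, hvw⟩
    have h2 := G.degree_le_maxDegree v
    omega)
  have h1 : X ⊆ {r} := by
    intro x hx
    simpa using this hx
  have := Finset.card_le_card h1
  rw [hX.1, Finset.card_singleton] at this
  omega

/-- The time for one step of backtracking. -/
def stepTime (n k D : ℕ) : ℕ :=
  if k < n then 8 * stackBound n k D + k * (12 * (1 + D)) + 14 * k + 40 else 12

/-- The time between two outputs. There is at most one output if `n ≤ k`. -/
def outputDelay (n k D : ℕ) : ℕ :=
  if k < n then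
    stackBound n k D * (stepTime n k D + 1) + stepTime n k D + 8 * stackBound n k D + 20
  else 0

/-- For `k < n` and `D > 0` the minimum is positive, so that the stack bound is at most
`2 * (k * min (n - k) (k * D))`. -/
lemma outputDelay_le {D : ℕ} (hk : 0 < k) (hD : 2 ≤ k → 0 < D) :
    outputDelay n k D ≤ 390 * max 1 ((k * min (n - k) (k * D)) ^ 2 * D) := by
  unfold outputDelay
  split_ifs with hkn
  · rcases Nat.eq_zero_or_pos D with rfl | hD0
    · obtain rfl : k = 1 := by
        by_contra h
        exact absurd (hD (by omega)) (lt_irrefl 0)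
      simp [stepTime, stackBound, hkn]
    · have hμ : 0 < min (n - k) (k * D) := lt_min (by omega) (Nat.mul_pos hk hD0)
      simp only [stepTime, stackBound, if_pos hkn]
      generalize min (n - k) (k * D) = μ at *
      refine le_trans ?_ (Nat.mul_le_mul_left _ (le_max_right _ _))
      have h1 : k + μ ≤ 2 * (k * μ) := by nlinarith
      have h2 : 1 ≤ k * μ := Nat.mul_pos hk hμ
      have h3 : k * μ ≤ k * μ * D := Nat.le_mul_of_pos_right _ hD0
      have h4 : k * (12 * (1 + D)) ≤ 24 * (k * μ * D) := by
        have : k * (1 + D) ≤ k * (2 * (μ * D)) := Nat.mul_le_mul_left _ (by nlinarith)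
        nlinarith
      have h5 : k ≤ k * μ := Nat.le_mul_of_pos_right _ hμ
      have h6 : 8 * (k + μ) + k * (12 * (1 + D)) + 14 * k + 40 ≤ 94 * (k * μ * D) := by omega
      have h7 : (k + μ) * (8 * (k + μ) + k * (12 * (1 + D)) + 14 * k + 40 + 1) ≤
          2 * (k * μ) * (95 * (k * μ * D)) := Nat.mul_le_mul h1 (by omega)
      have h8 : k * μ * D ≤ (k * μ) ^ 2 * D := by
        refine Nat.mul_le_mul_right _ ?_
        rw [sq]
        exact Nat.le_mul_of_pos_right _ h2
      have h9 : 2 * (k * μ) * (95 * (k * μ * D)) = 190 * ((k * μ) ^ 2 * D) := by ring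
      omega
  · exact Nat.zero_le _

lemma le_delayBound {D : ℕ} (hk : 0 < k) :
    (((k * min (n - k) (k * D)) ^ 2 * D : ℕ) : ℝ) ≤ delayBound n k D := by
  have : 0 ≤ Real.logb 2 (k : ℝ) := Real.logb_nonneg (by norm_num) (by exact_mod_cast hk)
  unfold delayBound
  push_cast
  gcongr
  linarith

lemma Progress.enumerates {out : List (ℕ × List ℕ)} (h : Progress G k out ∅) :
    Enumerates G k (out.map Prod.snd) := by
  obtain ⟨L, h1, h2, h3, h4, -⟩ := h
  have h5 : (out.map Prod.snd).map List.toFinset = L.map fun X => X.map Fin.valEmbedding := by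
    rw [← h1, List.map_map]
    rfl
  refine ⟨?_, ?_, ?_⟩
  · simp only [List.mem_map]
    rintro _ ⟨o, ho, rfl⟩
    exact h2 o ho
  · rw [h5]
    exact h3.map (Finset.map_injective _)
  · intro Y
    rw [h5, List.mem_map]
    simp only [h4, Set.mem_empty_iff_false, or_false]

lemma Progress.exists_mem {out : List (ℕ × List ℕ)} (h : Progress G k out ∅) (hne : out ≠ []) :
    ∃ X, X ∈ connectedSets G k := by
  obtain ⟨L, h1, -, -, h4, -⟩ := h
  obtain ⟨X, hX⟩ : ∃ X, X ∈ L := by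
    refine List.exists_mem_of_ne_nil _ ?_
    rintro rfl
    simp at h1
    exact hne h1
  exact ⟨X, (h4 X).2 (Or.inl hX)⟩

end

end ConnectedSets

open ConnectedSets

theorem theorem1 :
    ∃ (P : WordRAM.Prog) (C : ℕ),
      ∀ (n k : ℕ) (G : SimpleGraph (Fin n)) [DecidableRel G.Adj] (adj : Fin n → List (Fin n)),
        0 < k → ConnectedSets.IsAdjacencyList G adj →
        ∃ s : WordRAM.State,
          -- the run halts, within `C * (n + m + 1)` memory cells of `O(log (n + k))` bits
          WordRAM.Exec (C * (n + G.edgeFinset.card + 1)) ((n + k + 2) ^ C) P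
            (WordRAM.initState (ConnectedSets.encode k adj)) s ∧
          -- the outputs are the connected `k`-sets, each exactly once
          ConnectedSets.Enumerates G k (s.out.map Prod.snd) ∧
          -- time between any two successive outputs
          s.out.IsChain (fun a b => (b.1 : ℝ) - (a.1 : ℝ) ≤
            C * max 1 (ConnectedSets.delayBound n k G.maxDegree)) ∧
          -- time before the first output
          (∀ o ∈ s.out.head?, (o.1 : ℝ) ≤
            C * (n + G.edgeFinset.card + 1 + ConnectedSets.delayBound n k G.maxDegree)) ∧
          -- time from the last output (or from the start, if there is none) until halting
          (s.clock : ℝ) - ((s.out.map Prod.fst).getLastD 0 : ℕ) ≤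
            C * (n + G.edgeFinset.card + 1 + ConnectedSets.delayBound n k G.maxDegree) := by
  -- A variable for the constant keeps the power that bounds the words from being evaluated.
  obtain ⟨C, hC⟩ : ∃ C : ℕ, C = 400 := ⟨400, rfl⟩
  refine ⟨mainProg, C, fun n k G _ adj hk hadj => ?_⟩
  have hsum := sum_length hadj
  have hL := inputSize_eq hadj
  have hm : 2 * G.edgeFinset.card ≤ n * n := by
    rw [← G.sum_degrees_eq_twice_card_edges]
    refine (Finset.sum_le_card_nsmul _ _ n fun v _ => ?_).trans (by simp)
    exact (G.degree_lt_card_verts v).le.trans (by simp)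
  have hW : inputSize adj + 4 * n + k + 4 ≤ (n + k + 2) ^ C := by
    calc inputSize adj + 4 * n + k + 4 ≤ (n + k + 2) ^ 4 := by
          have h1 : 3 ≤ n + k + 2 := by omega
          have h2 : (n + k + 2) ^ 2 * 3 ^ 2 ≤ (n + k + 2) ^ 2 * (n + k + 2) ^ 2 :=
            Nat.mul_le_mul_left _ (Nat.pow_le_pow_left h1 2)
          nlinarith
      _ ≤ (n + k + 2) ^ C := Nat.pow_le_pow_right (by omega) (by omega)
  generalize (n + k + 2) ^ C = W at hW ⊢
  have hbounds : Bounds adj k G.maxDegree (stepTime n k G.maxDegree)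
      (prepTime adj + 20 * ∑ v, (1 + (adj v).length) + 8 * stackBound n k G.maxDegree + 21)
      (outputDelay n k G.maxDegree) := by
    refine ⟨fun v => ?_, ?_, fun h => ?_, fun h => ?_⟩
    · rw [length_eq_degree hadj]
      exact G.degree_le_maxDegree v
    · unfold stepTime
      split_ifs <;> omega
    · rw [stepTime, if_pos h]
    · rw [outputDelay, if_pos h]
  obtain ⟨s, hs, ⟨hchain, hhead⟩, hprog, hnone, hsome⟩ :=
    run_main (S := C * (n + G.edgeFinset.card + 1)) (W := W) hadj hk
      ⟨by omega, by rw [hC]; omega, by omega⟩ (by omega) hbounds le_rfl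
  have hp : 0 ≤ delayBound n k G.maxDegree := le_trans (Nat.cast_nonneg _) (le_delayBound hk)
  have hprep : prepTime adj ≤ 46 * n + 68 * G.edgeFinset.card + 11 := by
    rw [prepTime, hsum]
    omega
  have hC' : (C : ℝ) = 400 := by rw [hC]; norm_num
  have hprep' : (prepTime adj : ℝ) ≤ 46 * n + 68 * G.edgeFinset.card + 11 := by exact_mod_cast hprep
  rw [hC']
  by_cases hne : s.out = []
  · have hclock : (s.clock : ℝ) ≤ prepTime adj + 1 := by exact_mod_cast hnone hne
    refine ⟨s, hs, hprog.enumerates, ?_, ?_, ?_⟩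
    · rw [hne]
      exact List.isChain_nil
    · simp [hne]
    · rw [hne]
      simp only [List.map_nil, List.getLastD_nil, Nat.cast_zero, sub_zero]
      have : (0 : ℝ) ≤ n := Nat.cast_nonneg _
      have : (0 : ℝ) ≤ G.edgeFinset.card := Nat.cast_nonneg _
      linarith
  obtain ⟨X, hX⟩ := hprog.exists_mem hne
  have hkn : k ≤ n := by
    rw [← hX.1]
    simpa using Finset.card_le_univ X
  have hdelay : (outputDelay n k G.maxDegree : ℝ) ≤
      390 * max 1 (delayBound n k G.maxDegree) := by
    have h1 : (outputDelay n k G.maxDegree : ℝ) ≤ ((390 * max 1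
        ((k * min (n - k) (k * G.maxDegree)) ^ 2 * G.maxDegree) : ℕ) : ℝ) := by
      exact_mod_cast outputDelay_le hk (maxDegree_pos hX)
    refine h1.trans ?_
    rw [Nat.cast_mul, Nat.cast_max, Nat.cast_one, Nat.cast_ofNat]
    exact mul_le_mul_of_nonneg_left (max_le_max_left _ (le_delayBound hk)) (by norm_num)
  have hmax : max 1 (delayBound n k G.maxDegree) ≤ 1 + delayBound n k G.maxDegree :=
    max_le (by linarith) (by linarith)
  have hone : 1 ≤ max 1 (delayBound n k G.maxDegree) := le_max_left _ _
  have hstack : stackBound n k G.maxDegree ≤ n := by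
    have := min_le_left (n - k) (k * G.maxDegree)
    unfold stackBound
    omega
  refine ⟨s, hs, hprog.enumerates, ?_, ?_, ?_⟩
  · refine hchain.imp fun a b hab => ?_
    have : (b.1 : ℝ) ≤ a.1 + outputDelay n k G.maxDegree := by exact_mod_cast hab
    linarith
  · intro o ho
    have h1 : o.1 ≤ 46 * n + 68 * G.edgeFinset.card + 11 +
        20 * (n + 2 * G.edgeFinset.card) + 8 * n + 21 := by
      have := hhead o ho
      rw [hsum] at this
      omega
    have h2 : (o.1 : ℝ) ≤ 46 * n + 68 * G.edgeFinset.card + 11 +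
        20 * (n + 2 * G.edgeFinset.card) + 8 * n + 21 := by exact_mod_cast h1
    have : (0 : ℝ) ≤ n := Nat.cast_nonneg _
    have : (0 : ℝ) ≤ G.edgeFinset.card := Nat.cast_nonneg _
    linarith
  · have h1 := hsome hne
    have h2 : stackBound n k G.maxDegree * (stepTime n k G.maxDegree + 1) ≤
        outputDelay n k G.maxDegree + 13 * n := by
      unfold outputDelay
      split_ifs with h
      · omega
      · rw [stepTime, if_neg h]
        omega
    have h3 : (s.clock : ℝ) ≤ lastTime s.out + outputDelay n k G.maxDegree + 13 * n + 4 := by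
      have : s.clock ≤ lastTime s.out + outputDelay n k G.maxDegree + 13 * n + 4 := by omega
      exact_mod_cast this
    have : (0 : ℝ) ≤ n := Nat.cast_nonneg _
    have : (0 : ℝ) ≤ G.edgeFinset.card := Nat.cast_nonneg _
    change (s.clock : ℝ) - (lastTime s.out : ℕ) ≤ _
    linarith
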